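/- Let $e_1,\dots,e_8$ be the standard basis of $\mathbb{R}^8$ and, for $S\subseteq\{1,\dots,8\}$, let $x_S\in\mathbb{R}^8$ have entries $-1$ at the coordinates in $S$ and $1$ elsewhere. Let $\Psi_{E_8}$ consist of the $240$ vectors $\pm e_i\pm e_j$ ($1\le i<j\le 8$) and $x\in\{\pm1\}^8$ with $\prod_i x_i=1$. Let $G_{E_8}$ be the graph whose vertices $v_x$ are the elements $x\in\Psi_{E_8}$ up to sign ($v_x=v_{-x}$), with $v_x,v_y$ adjacent iff $\langle x,y\rangle=0$. Let $V_1,\dots,V_{15}$ be the following sets of vertices (listed by representing vectors): \begin{align*} V_1:\ & e_1\pm e_2,\ e_3\pm e_4,\ e_5\pm e_6,\ e_7\pm e_8\\ V_2:\ & e_1\pm e_3,\ e_2\pm e_4,\ e_5\pm e_7,\ e_6\pm e_8\\ V_3:\ & e_1\pm e_4,\ e_2\pm e_3,\ e_5\pm e_8,\ e_6\pm e_7\\ V_4:\ & e_1\pm e_5,\ e_2\pm e_6,\ e_3\pm e_7,\ e_4\pm e_8\\ V_5:\ & e_1\pm e_6,\ e_2\pm e_5,\ e_3\pm e_8,\ e_4\pm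 e_7\\ V_6:\ & e_1\pm e_7,\ e_2\pm e_8,\ e_3\pm e_5,\ e_4\pm e_6\\ V_7:\ & e_1\pm e_8,\ e_2\pm e_7,\ e_3\pm e_6,\ e_4\pm e_5\\ V_8:\ & x_{\{1,2\}}, x_{\{3,4\}}, x_{\{5,6\}}, x_{\{7,8\}}, x_{\{1,4,6,8\}}, x_{\{2,3,6,8\}}, x_{\{2,4,5,8\}}, x_{\{2,4,6,7\}}\\ V_9:\ & x_{\{1,3\}}, x_{\{2,4\}}, x_{\{5,7\}}, x_{\{6,8\}}, x_{\{1,4,7,8\}}, x_{\{1,4,5,6\}}, x_{\{1,2,6,7\}}, x_{\{1,2,5,8\}}\\ V_{10}:\ & x_{\{1,4\}}, x_{\{2,3\}}, x_{\{5,8\}}, x_{\{6,7\}}, x_{\{1,3,7,8\}}, x_{\{1,3,5,6\}}, x_{\{1,2,5,7\}}, x_{\{1,2,6,8\}}\\ V_{11}:\ & x_{\{1,5\}}, x_{\{2,6\}}, x_{\{3,7\}}, x_{\{4,8\}}, x_{\{1,6,7,8\}}, x_{\{2,5,7,8\}}, x_{\{4,5,6,7\}}, x_{\{1,2,4,7\}}\\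 V_{12}:\ & x_{\{1,6\}}, x_{\{2,5\}}, x_{\{3,8\}}, x_{\{4,7\}}, x_{\{1,5,7,8\}}, x_{\{2,6,7,8\}}, x_{\{3,5,6,7\}}, x_{\{4,5,6,8\}}\\ V_{13}:\ & x_{\{1,7\}}, x_{\{2,8\}}, x_{\{3,5\}}, x_{\{4,6\}}, x_{\{1,5,6,8\}}, x_{\{3,6,7,8\}}, x_{\{2,5,6,7\}}, x_{\{4,5,7,8\}}\\ V_{14}:\ & x_{\{1,8\}}, x_{\{2,7\}}, x_{\{3,6\}}, x_{\{4,5\}}, x_{\{1,5,6,7\}}, x_{\{4,6,7,8\}}, x_{\{2,5,6,8\}}, x_{\{3,5,7,8\}}\\ V_{15}:\ & x_\emptyset, x_{\{5,6,7,8\}}, x_{\{3,4,7,8\}}, x_{\{2,4,6,8\}}, x_{\{3,4,5,6\}}, x_{\{2,4,5,7\}}, x_{\{2,3,6,7\}}, x_{\{2,3,5,8\}} \end{align*} Let $w_{j-1}=e_1-e_j$ and $w_{j+6}=x_{\{1,j\}}$ for $2\le j\le 8$, and $w_{15}=x_\emptyset$ (so $w_i$ represents a vertex of $V_i$). Let $G^{\boldsymbol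 w}$ be the graph on the same vertices in which, for $s\in V_i$, $t\in V_j$: if $\langle w_i,w_j\rangle\neq0$, then $s,t$ are adjacent iff they are adjacent in $G_{E_8}$; if $\langle w_i,w_j\rangle=0$, then $s,t$ are adjacent iff they are not adjacent in $G_{E_8}$. Let $\pi=\{C_1,\dots,C_k,D\}$ be a partition of the vertex set of a finite graph $G$ into nonempty sets such that (i) for all $i,j\le k$ any two vertices of $C_i$ have the same number of neighbours in $C_j$, and (ii) every $v\in D$ has $0$, $|C_i|/2$ or $|C_i|$ neighbours in $C_i$, for each $i\le k$. The Godsil–McKay switched graph $G^{\pi,D}$ is obtained from $G$ as follows: for each $v\in D$ and $i\le k$ such that $v$ has exactly $|C_i|/2$ neighbours in $C_i$, delete the edges from $v$ to these and join $v$ to the other $|C_i|/2$ vertices of $C_i$. Two finite graphs $G_1,G_2$ are quantum isomorphic if there are a nonzero unital $C^*$-algebra $\mathcal A$ and a matrix $u$ over $\mathcal A$, with rows indexed by $V(G_1)$ and columns by $V(G_2)$, whose entries are projections, whose rows and columns all sum to $1$, and which satisfies $A_{G_1}u=uA_{G_2}$ for the adjacency matrices. Claim. Let $\pi=\{V_1,\dots,V_{15}\}$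 and $D=V_{15}$. Then $\pi$ is a partition of the vertex set into sets of size $8$; in both $G_{E_8}$ and $G^{\boldsymbol w}$ every vertex of $V_i$ has exactly $4$ neighbours in $V_j$ whenever $i\ne j$, and conditions (i) and (ii) hold. The switched graphs $(G_{E_8})^{\pi,V_{15}}$ and $(G^{\boldsymbol w})^{\pi,V_{15}}$ are quantum isomorphic, not isomorphic to each other, and both strongly regular with parameters $(120,63,30,36)$. Their independence numbers satisfy $\alpha((G_{E_8})^{\pi,V_{15}})\le 9$ and $\alpha((G^{\boldsymbol w})^{\pi,V_{15}})\ge 14$. Moreover, neither of the two switched graphs is isomorphic to $G_{E_8}$ or to $G^{\boldsymbol w}$. -/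

import Mathlib

open Matrix

/-! ### Quantum isomorphism of graphs -/

/-- A quantum permutation matrix (magic unitary) with entries in a unital C*-algebra: the entries
are projections and every row and every column sums to `1`. -/
structure IsQuantumPermutation {V W A : Type*} [Fintype V] [Fintype W] [CStarAlgebra A]
    (u : Matrix V W A) : Prop where
  isStarProjection : ∀ i j, IsStarProjection (u i j)
  row_sum : ∀ i, ∑ j, u i j = 1
  col_sum : ∀ j, ∑ i, u i j = 1

open Classical in
/-- Finite graphs `G`, `H` are quantum isomorphic if `A_G u = u A_H` for some quantum permutation
matrix `u` over some nonzero unital C*-algebra (over the zero algebra the condition is void). -/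
def QuantumIsomorphic {V W : Type*} [Fintype V] [Fintype W]
    (G : SimpleGraph V) (H : SimpleGraph W) : Prop :=
  ∃ (A : Type) (_ : CStarAlgebra A) (_ : Nontrivial A) (u : Matrix V W A),
    IsQuantumPermutation u ∧ G.adjMatrix A * u = u * H.adjMatrix A

/-! ### Godsil-McKay switching -/

/-- `GMPartition G C D`: the sets `C i` together with `D` partition the vertex set, and satisfy the
two conditions of Godsil-McKay switching. -/
structure GMPartition {V ι : Type*} [Finite V] (G : SimpleGraph V) (C : ι → Set V) (D : Set V) :
    Prop where
  nonempty : ∀ i, (C i).Nonempty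
  nonempty_D : D.Nonempty
  disjoint : Pairwise fun i j => Disjoint (C i) (C j)
  disjoint_D : ∀ i, Disjoint (C i) D
  cover : (⋃ i, C i) ∪ D = Set.univ
  equitable : ∀ i j, ∀ u ∈ C i, ∀ v ∈ C i,
    (G.neighborSet u ∩ C j).ncard = (G.neighborSet v ∩ C j).ncard
  zero_half_all : ∀ v ∈ D, ∀ i, (G.neighborSet v ∩ C i).ncard = 0 ∨
    2 * (G.neighborSet v ∩ C i).ncard = (C i).ncard ∨
    (G.neighborSet v ∩ C i).ncard = (C i).ncard

/-- The pair `v ∈ D`, `u ∈ C i` is toggled by the switching: `v` has exactly `|C i| / 2` neighbours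
in `C i`. -/
def GMToggled {V ι : Type*} [Finite V] (G : SimpleGraph V) (C : ι → Set V) (D : Set V)
    (v u : V) : Prop :=
  v ∈ D ∧ ∃ i, u ∈ C i ∧ 2 * (G.neighborSet v ∩ C i).ncard = (C i).ncard

/-- The graph obtained from `G` by Godsil-McKay switching: adjacency is complemented on toggled
pairs and unchanged elsewhere. (The clause `u ≠ v` is automatic when the `C i` and `D` are
disjoint.) -/
def gmSwitch {V ι : Type*} [Finite V] (G : SimpleGraph V) (C : ι → Set V) (D : Set V) :
    SimpleGraph V where
  Adj u v := u ≠ v ∧ Xor (G.Adj u v) (GMToggled G C D u v ∨ GMToggled G C D v u)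
  symm := ⟨fun u v h => ⟨h.1.symm, by
    rw [G.adj_comm, or_comm]
    exact h.2⟩⟩
  loopless := ⟨fun _ h => h.1 rfl⟩

/-! ### The orthogonality graph of the lines of the `E₈` root system -/

/-- The standard basis vector `e_k` of `ℝ⁸`, with coordinates numbered `k = 1, …, 8`. -/
noncomputable def stdVec (k : ℕ) : Fin 8 → ℝ := fun i => if (i : ℕ) + 1 = k then 1 else 0

/-- The vector `x_S` with entry `-1` at the coordinates in `S ⊆ {1, …, 8}` and `1` elsewhere. -/
noncomputable def signVec (S : Finset ℕ) : Fin 8 → ℝ := fun i => if (i : ℕ) + 1 ∈ S then -1 else 1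

/-- The 240 vectors of the `E₈` root system (the second kind is not halved; only the spanned
lines and their orthogonality matter). -/
def e8Roots : Set (Fin 8 → ℝ) :=
  {x | ∃ i j : ℕ, 1 ≤ i ∧ i < j ∧ j ≤ 8 ∧ ∃ s t : ℝ, (s = 1 ∨ s = -1) ∧ (t = 1 ∨ t = -1) ∧
    x = s • stdVec i + t • stdVec j} ∪
  {x | (∀ i, x i = 1 ∨ x i = -1) ∧ ∏ i, x i = 1}

/-- Identification of `x` and `-x`. -/
instance e8Setoid : Setoid e8Roots where
  r x y := (x : Fin 8 → ℝ) = y ∨ (x : Fin 8 → ℝ) = -y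
  iseqv :=
    { refl := fun _ => Or.inl rfl
      symm := by
        rintro x y (h | h)
        · exact Or.inl h.symm
        · exact Or.inr (by rw [h, neg_neg])
      trans := by
        rintro x y z (h | h) (h' | h')
        · exact Or.inl (h.trans h')
        · exact Or.inr (h.trans h')
        · exact Or.inr (by rw [h, h'])
        · exact Or.inl (by rw [h, h', neg_neg]) }

/-- The vertices `v_x`: roots up to sign. -/
abbrev E8Line : Type := Quotient e8Setoid

theorem e8Roots_finite : e8Roots.Finite := by
  have hf : (Set.pi Set.univ fun _ : Fin 8 => ({-1, 0, 1} : Set ℝ)).Finite :=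
    Set.Finite.pi fun _ => Set.toFinite _
  refine hf.subset ?_
  rintro x (⟨i, j, -, hij, -, s, t, hs, ht, rfl⟩ | ⟨hx, -⟩) k -
  · have : ¬ ((k : ℕ) + 1 = i ∧ (k : ℕ) + 1 = j) := by omega
    simp only [stdVec, Pi.add_apply, Pi.smul_apply, smul_eq_mul]
    rcases hs with rfl | rfl <;> rcases ht with rfl | rfl <;> split_ifs <;> simp_all
  · rcases hx k with h | h <;> simp [h]

instance : Finite e8Roots := e8Roots_finite.to_subtype

noncomputable instance : Fintype E8Line := Fintype.ofFinite _

/-- `G_{E₈}`: lines are adjacent iff they are orthogonal. -/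
def e8Graph : SimpleGraph E8Line where
  Adj := Quotient.lift₂ (fun x y : e8Roots => (x : Fin 8 → ℝ) ⬝ᵥ (y : Fin 8 → ℝ) = 0) (by
    rintro a b c d (h | h) (h' | h') <;> simp [h, h'])
  symm := ⟨by
    rintro ⟨x⟩ ⟨y⟩ h
    exact (dotProduct_comm _ _).trans h⟩
  loopless := ⟨by
    rintro ⟨⟨x, hx⟩⟩ h
    have h0 : x = 0 := dotProduct_self_eq_zero.mp h
    subst h0
    rcases hx with ⟨i, j, hi, hij, hj, s, t, hs, ht, he⟩ | ⟨he, -⟩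
    · have h1 := congrFun he ⟨i - 1, by omega⟩
      have h2 : i - 1 + 1 = i := by omega
      have h3 : i ≠ j := by omega
      simp only [stdVec, Pi.zero_apply, Pi.add_apply, Pi.smul_apply, h2, h3] at h1
      rcases hs with rfl | rfl <;> simp at h1
    · simpa using he 0⟩

/-! ### The partition into 15 cliques and the graph `G^w` -/

/-- The two vectors `e_i ± e_j`. -/
noncomputable def pmPair (i j : ℕ) : List (Fin 8 → ℝ) := [stdVec i + stdVec j, stdVec i - stdVec j]

/-- The lists of vectors of the orbits `V_1, …, V_15`; the index `k` stands for `V_{k+1}`. -/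
noncomputable def blockVectors : Fin 15 → List (Fin 8 → ℝ) := ![
  pmPair 1 2 ++ pmPair 3 4 ++ pmPair 5 6 ++ pmPair 7 8,
  pmPair 1 3 ++ pmPair 2 4 ++ pmPair 5 7 ++ pmPair 6 8,
  pmPair 1 4 ++ pmPair 2 3 ++ pmPair 5 8 ++ pmPair 6 7,
  pmPair 1 5 ++ pmPair 2 6 ++ pmPair 3 7 ++ pmPair 4 8,
  pmPair 1 6 ++ pmPair 2 5 ++ pmPair 3 8 ++ pmPair 4 7,
  pmPair 1 7 ++ pmPair 2 8 ++ pmPair 3 5 ++ pmPair 4 6,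
  pmPair 1 8 ++ pmPair 2 7 ++ pmPair 3 6 ++ pmPair 4 5,
  [{1, 2}, {3, 4}, {5, 6}, {7, 8}, {1, 4, 6, 8}, {2, 3, 6, 8}, {2, 4, 5, 8}, {2, 4, 6, 7}].map
    signVec,
  [{1, 3}, {2, 4}, {5, 7}, {6, 8}, {1, 4, 7, 8}, {1, 4, 5, 6}, {1, 2, 6, 7}, {1, 2, 5, 8}].map
    signVec,
  [{1, 4}, {2, 3}, {5, 8}, {6, 7}, {1, 3, 7, 8}, {1, 3, 5, 6}, {1, 2, 5, 7}, {1, 2, 6, 8}].map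
    signVec,
  [{1, 5}, {2, 6}, {3, 7}, {4, 8}, {1, 6, 7, 8}, {2, 5, 7, 8}, {4, 5, 6, 7}, {1, 2, 4, 7}].map
    signVec,
  [{1, 6}, {2, 5}, {3, 8}, {4, 7}, {1, 5, 7, 8}, {2, 6, 7, 8}, {3, 5, 6, 7}, {4, 5, 6, 8}].map
    signVec,
  [{1, 7}, {2, 8}, {3, 5}, {4, 6}, {1, 5, 6, 8}, {3, 6, 7, 8}, {2, 5, 6, 7}, {4, 5, 7, 8}].map
    signVec,
  [{1, 8}, {2, 7}, {3, 6}, {4, 5}, {1, 5, 6, 7}, {4, 6, 7, 8}, {2, 5, 6, 8}, {3, 5, 7, 8}].map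
    signVec,
  [∅, {5, 6, 7, 8}, {3, 4, 7, 8}, {2, 4, 6, 8}, {3, 4, 5, 6}, {2, 4, 5, 7}, {2, 3, 6, 7},
    {2, 3, 5, 8}].map signVec]

/-- The set of vertices `V_{k+1}`. -/
def e8Block (k : Fin 15) : Set E8Line :=
  {v | ∃ x : e8Roots, (x : Fin 8 → ℝ) ∈ blockVectors k ∧ v = ⟦x⟧}

/-- The graph `G^w` for representatives `w_k` of the blocks `V_k`: adjacency of `G_{E₈}` is
complemented between `V_i` and `V_j` exactly when `w_i ⊥ w_j`. (For nonzero `w_i` no pair inside a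
block is changed, and the clause `s ≠ t` is automatic.) -/
def twistedGraph (w : Fin 15 → Fin 8 → ℝ) : SimpleGraph E8Line where
  Adj s t := s ≠ t ∧ ∃ i j, s ∈ e8Block i ∧ t ∈ e8Block j ∧
    ((w i ⬝ᵥ w j ≠ 0 ∧ e8Graph.Adj s t) ∨ (w i ⬝ᵥ w j = 0 ∧ ¬ e8Graph.Adj s t))
  symm := ⟨by
    rintro s t ⟨hne, i, j, hi, hj, h⟩
    refine ⟨hne.symm, j, i, hj, hi, ?_⟩
    rwa [dotProduct_comm, e8Graph.adj_comm]⟩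
  loopless := ⟨fun _ h => h.1 rfl⟩

/-- The representatives `e_1 - e_j`, `x_{1,j}` for `j = 2, …, 8`, and `x_∅`. -/
noncomputable def e8Reps : Fin 15 → Fin 8 → ℝ := ![
  stdVec 1 - stdVec 2, stdVec 1 - stdVec 3, stdVec 1 - stdVec 4, stdVec 1 - stdVec 5,
  stdVec 1 - stdVec 6, stdVec 1 - stdVec 7, stdVec 1 - stdVec 8,
  signVec {1, 2}, signVec {1, 3}, signVec {1, 4}, signVec {1, 5},
  signVec {1, 6}, signVec {1, 7}, signVec {1, 8},
  signVec ∅]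

/-- The graph `G^w` for the representatives above. -/
noncomputable def e8TwistedGraph : SimpleGraph E8Line := twistedGraph e8Reps

/-- The cells `V_1, …, V_14` of the switching partition. -/
def e8Cells (k : Fin 14) : Set E8Line := e8Block k.castSucc

/-- The special cell `D = V_15`. -/
def e8Special : Set E8Line := e8Block (Fin.last 14)

/-- The graph `(G_{E₈})^{π, V_15}`. -/
def switchedE8Graph : SimpleGraph E8Line := gmSwitch e8Graph e8Cells e8Special

/-- The graph `(G^w)^{π, V_15}`. -/
noncomputable def switchedTwistedGraph : SimpleGraph E8Line :=
  gmSwitch e8TwistedGraph e8Cells e8Special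

/-! Each block is an orthogonal frame of eight lines. Its lines can be numbered by the group of
three-bit numbers under exclusive or, with 0 for the representative, so that for p ≠ q the lines (p,
a) and (q, b) are orthogonal iff ε(p,q) χ(a) χ'(b) = 1. Here χ and χ' are nontrivial characters
depending only on (p, q), and ε(p,q) = `repSign p q` is 1 iff the representatives are orthogonal
(`scaled_dotProduct_of_lt`). Thus G_{E₈} is `signGraph repSign`, G^w is the sign graph of the
constant -1, and, since a nontrivial character takes each value four times, Godsil-McKay switching
just negates ε between V_15 and the other blocks (`gmSwitch_adj`).

Strong regularity: the blocks are the points of PG(3,2), and the character by which q splits p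
depends only on the line through p and q (`thirdBlock_spec`). Character orthogonality then gives the
parameters for every symmetric ±1-valued ε with product -1 on each projective line, a condition that
switching preserves.

Quantum isomorphism: let P(p, d) be the projection onto a line and put u((p,a),(q,b)) = P(p, a xor
b) if p = q and 0 otherwise. The symmetries Σ χ(a) P(p, a) and Σ χ'(b) P(q, b) agree up to the
factor -ε(p,q) (`sum_blockChar_smul_lineProj`), so u intertwines the sign graphs of any two sign
functions with quotient -`repSign`.

Non-isomorphism: nine vectors in dimension eight are dependent, and a primitive integer relation
reduced mod 2 is a nonzero singular vector in the radical of their Gram form. This obstruction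
(`not_e8Graph_configuration`) excludes nine pairwise non-orthogonal lines, so α(G_{E₈}) ≤ 8 and the
switched graph has α ≤ 9. On the twisted side the representatives give α ≥ 15 before switching and α
≥ 14 after it, and a magic-square parity argument shows that 15 is not reached after switching.
These bounds separate all the required pairs except the switched E₈ graph and G_{E₈}; there the same
obstruction is applied to nine explicit lines. -/

/-! ### Integer coordinates of the root lines -/

/-- The integer vector `e_k`. -/
def intStd (k : ℕ) : Fin 8 → ℤ := fun i => if (i : ℕ) + 1 = k then 1 else 0

/-- The integer vector `x_S`. -/
def intSign (S : Finset ℕ) : Fin 8 → ℤ := fun i => if (i : ℕ) + 1 ∈ S then -1 else 1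

/-- The integer vectors `e_i ± e_j`. -/
def intPair (i j : ℕ) : List (Fin 8 → ℤ) := [intStd i + intStd j, intStd i - intStd j]

/-- The integer version of `blockVectors`. -/
def intBlock : Fin 15 → List (Fin 8 → ℤ) := ![
  intPair 1 2 ++ intPair 3 4 ++ intPair 5 6 ++ intPair 7 8,
  intPair 1 3 ++ intPair 2 4 ++ intPair 5 7 ++ intPair 6 8,
  intPair 1 4 ++ intPair 2 3 ++ intPair 5 8 ++ intPair 6 7,
  intPair 1 5 ++ intPair 2 6 ++ intPair 3 7 ++ intPair 4 8,
  intPair 1 6 ++ intPair 2 5 ++ intPair 3 8 ++ intPair 4 7,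
  intPair 1 7 ++ intPair 2 8 ++ intPair 3 5 ++ intPair 4 6,
  intPair 1 8 ++ intPair 2 7 ++ intPair 3 6 ++ intPair 4 5,
  [{1, 2}, {3, 4}, {5, 6}, {7, 8}, {1, 4, 6, 8}, {2, 3, 6, 8}, {2, 4, 5, 8}, {2, 4, 6, 7}].map
    intSign,
  [{1, 3}, {2, 4}, {5, 7}, {6, 8}, {1, 4, 7, 8}, {1, 4, 5, 6}, {1, 2, 6, 7}, {1, 2, 5, 8}].map
    intSign,
  [{1, 4}, {2, 3}, {5, 8}, {6, 7}, {1, 3, 7, 8}, {1, 3, 5, 6}, {1, 2, 5, 7}, {1, 2, 6, 8}].map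
    intSign,
  [{1, 5}, {2, 6}, {3, 7}, {4, 8}, {1, 6, 7, 8}, {2, 5, 7, 8}, {4, 5, 6, 7}, {1, 2, 4, 7}].map
    intSign,
  [{1, 6}, {2, 5}, {3, 8}, {4, 7}, {1, 5, 7, 8}, {2, 6, 7, 8}, {3, 5, 6, 7}, {4, 5, 6, 8}].map
    intSign,
  [{1, 7}, {2, 8}, {3, 5}, {4, 6}, {1, 5, 6, 8}, {3, 6, 7, 8}, {2, 5, 6, 7}, {4, 5, 7, 8}].map
    intSign,
  [{1, 8}, {2, 7}, {3, 6}, {4, 5}, {1, 5, 6, 7}, {4, 6, 7, 8}, {2, 5, 6, 8}, {3, 5, 7, 8}].map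
    intSign,
  [∅, {5, 6, 7, 8}, {3, 4, 7, 8}, {2, 4, 6, 8}, {3, 4, 5, 6}, {2, 4, 5, 7}, {2, 3, 6, 7},
    {2, 3, 5, 8}].map intSign]

/-- For each block, the ordering of its lines by which bitwise exclusive or becomes a group
structure compatible with orthogonality; the line numbered `0` is the chosen representative. -/
def blockOrder : Fin 15 → Fin 8 → ℕ := ![
  ![1, 5, 3, 7, 0, 4, 2, 6], ![1, 4, 3, 6, 0, 5, 2, 7], ![1, 4, 3, 6, 0, 5, 2, 7],
  ![1, 4, 3, 6, 0, 5, 2, 7], ![1, 4, 3, 6, 0, 5, 2, 7], ![1, 4, 3, 6, 0, 5, 2, 7],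
  ![1, 4, 3, 6, 0, 5, 2, 7], ![0, 4, 2, 6, 1, 5, 3, 7], ![0, 2, 4, 6, 1, 3, 5, 7],
  ![0, 7, 4, 2, 1, 6, 5, 3], ![0, 2, 1, 3, 4, 7, 5, 6], ![0, 6, 1, 7, 4, 2, 5, 3],
  ![0, 2, 6, 7, 4, 5, 1, 3], ![0, 7, 6, 3, 4, 2, 1, 5], ![0, 3, 2, 6, 1, 5, 4, 7]]

/-- The vector of the line numbered `a` in the block `k`. -/
def rootVec (k : Fin 15) (a : Fin 8) : Fin 8 → ℤ := (intBlock k).getD (blockOrder k a) 0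

/-- Coercion of integer vectors to real vectors. -/
def toReal (x : Fin 8 → ℤ) : Fin 8 → ℝ := fun i => (x i : ℝ)

theorem toReal_add (x y : Fin 8 → ℤ) : toReal (x + y) = toReal x + toReal y := by
  funext i; simp [toReal]

theorem toReal_sub (x y : Fin 8 → ℤ) : toReal (x - y) = toReal x - toReal y := by
  funext i; simp [toReal]

theorem toReal_neg (x : Fin 8 → ℤ) : toReal (-x) = -toReal x := by
  funext i; simp [toReal]

theorem toReal_intStd (k : ℕ) : toReal (intStd k) = stdVec k := by
  funext i; simp [toReal, intStd, stdVec]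

theorem toReal_intSign (S : Finset ℕ) : toReal (intSign S) = signVec S := by
  funext i; simp [toReal, intSign, signVec]

theorem toReal_dotProduct (x y : Fin 8 → ℤ) : toReal x ⬝ᵥ toReal y = ((x ⬝ᵥ y : ℤ) : ℝ) := by
  simp [toReal, dotProduct]

theorem blockVectors_eq_map (k : Fin 15) : blockVectors k = (intBlock k).map toReal := by
  fin_cases k <;>
    simp [blockVectors, intBlock, pmPair, intPair, toReal_add, toReal_sub, toReal_intStd,
      toReal_intSign]

theorem exists_rootVec_eq : ∀ k, ∀ x ∈ intBlock k, ∃ a, x = rootVec k a := by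
  decide +kernel

theorem rootVec_mem : ∀ k a, rootVec k a ∈ intBlock k := by
  decide +kernel

theorem mem_blockVectors {k : Fin 15} {y : Fin 8 → ℝ} :
    y ∈ blockVectors k ↔ ∃ a, y = toReal (rootVec k a) := by
  rw [blockVectors_eq_map, List.mem_map]
  constructor
  · rintro ⟨x, hx, rfl⟩
    obtain ⟨a, rfl⟩ := exists_rootVec_eq k x hx
    exact ⟨a, rfl⟩
  · rintro ⟨a, rfl⟩
    exact ⟨_, rootVec_mem k a, rfl⟩

theorem e8Reps_eq (k : Fin 15) : e8Reps k = toReal (rootVec k 0) := by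
  fin_cases k <;>
    simp [e8Reps, rootVec, blockOrder, intBlock, intPair, toReal_sub, toReal_intStd,
      toReal_intSign]

/-- The integer vector with entries `±1` that is negative where `b` is true. -/
def boolSignVec (b : Fin 8 → Bool) : Fin 8 → ℤ := fun i => if b i then -1 else 1

theorem rootVec_cases : ∀ k a,
    ((∀ i, rootVec k a i = 1 ∨ rootVec k a i = -1) ∧ ∏ i, rootVec k a i = 1) ∨
    ∃ i : Fin 8, ∃ j : Fin 8, i < j ∧ (rootVec k a = intStd (i + 1) + intStd (j + 1) ∨
      rootVec k a = intStd (i + 1) - intStd (j + 1)) := by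
  decide +kernel

theorem toReal_rootVec_mem (k : Fin 15) (a : Fin 8) : toReal (rootVec k a) ∈ e8Roots := by
  rcases rootVec_cases k a with ⟨h, hp⟩ | ⟨i, j, hij, h⟩
  rotate_left
  · left
    have hij' : (i : ℕ) < j := hij
    rcases h with h | h
    · refine ⟨i + 1, j + 1, by omega, by omega, by omega, 1, 1, .inl rfl, .inl rfl, ?_⟩
      simp [h, toReal_add, toReal_intStd]
    · refine ⟨i + 1, j + 1, by omega, by omega, by omega, 1, -1, .inl rfl, .inr rfl, ?_⟩
      rw [h, toReal_sub, toReal_intStd, toReal_intStd]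
      simp [sub_eq_add_neg]
  · right
    refine ⟨fun i => ?_, ?_⟩
    · rcases h i with h | h <;> simp [toReal, h]
    · have := congrArg (Int.cast : ℤ → ℝ) hp
      simpa [toReal] using this

theorem exists_rootVec_of_pair : ∀ i j : Fin 8, i < j →
    ∀ x ∈ intPair (i + 1) (j + 1), ∃ k a, x = rootVec k a := by
  decide +kernel

/-- Eight separate Booleans make this a finite check over 2⁸ sign patterns. The shift by 7 skips the
blocks of vectors e_i ± e_j. -/
theorem exists_rootVec_of_signs : ∀ b₀ b₁ b₂ b₃ b₄ b₅ b₆ b₇ : Bool,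
    ∏ i, boolSignVec ![b₀, b₁, b₂, b₃, b₄, b₅, b₆, b₇] i = 1 →
    ∃ k : Fin 8, ∃ a, boolSignVec ![b₀, b₁, b₂, b₃, b₄, b₅, b₆, b₇] = rootVec (k.natAdd 7) a ∨
      boolSignVec ![b₀, b₁, b₂, b₃, b₄, b₅, b₆, b₇] = -rootVec (k.natAdd 7) a := by
  decide +kernel

theorem exists_rootVec_of_mem_e8Roots {x : Fin 8 → ℝ} (hx : x ∈ e8Roots) :
    ∃ k a, x = toReal (rootVec k a) ∨ x = -toReal (rootVec k a) := by
  rcases hx with ⟨i, j, hi, hij, hj, s, t, hs, ht, rfl⟩ | ⟨hx, hp⟩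
  · have key := exists_rootVec_of_pair ⟨i - 1, by omega⟩ ⟨j - 1, by omega⟩
      (by simp only [Fin.mk_lt_mk]; omega)
    simp only [Nat.sub_add_cancel hi, Nat.sub_add_cancel (hi.trans hij.le), intPair,
      List.mem_cons, List.not_mem_nil, or_false] at key
    obtain ⟨k, a, hplus⟩ := key _ (.inl rfl)
    obtain ⟨k', a', hminus⟩ := key _ (.inr rfl)
    have hplus := congrArg toReal hplus
    have hminus := congrArg toReal hminus
    rw [toReal_add, toReal_intStd, toReal_intStd] at hplus
    rw [toReal_sub, toReal_intStd, toReal_intStd] at hminus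
    rcases hs with rfl | rfl <;> rcases ht with rfl | rfl
    · exact ⟨k, a, .inl (by rw [← hplus]; simp)⟩
    · exact ⟨k', a', .inl (by rw [← hminus]; simp [sub_eq_add_neg])⟩
    · exact ⟨k', a', .inr (by rw [← hminus]; simp [sub_eq_add_neg, add_comm])⟩
    · exact ⟨k, a, .inr (by rw [← hplus]; simp [add_comm])⟩
  · classical
    have hxb : x = toReal (boolSignVec fun i => decide (x i = -1)) := by
      funext i
      rcases hx i with h | h
      · have : ¬ (1 : ℝ) = -1 := by norm_num
        simp [toReal, boolSignVec, h, this]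
      · simp [toReal, boolSignVec, h]
    generalize (fun i => decide (x i = -1)) = b at hxb
    subst hxb
    have hb : b = ![b 0, b 1, b 2, b 3, b 4, b 5, b 6, b 7] := by
      funext i
      fin_cases i <;> rfl
    have hp' : ∏ i, boolSignVec b i = 1 := by
      have : ((∏ i, boolSignVec b i : ℤ) : ℝ) = 1 := by simpa [toReal] using hp
      exact_mod_cast this
    rw [hb] at hp' ⊢
    obtain ⟨k, a, h | h⟩ := exists_rootVec_of_signs _ _ _ _ _ _ _ _ hp'
    · exact ⟨_, a, .inl (by rw [h])⟩
    · exact ⟨_, a, .inr (by rw [h, toReal_neg])⟩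

/-! ### The orthogonality relation in coordinates -/

/-- The character of the group of three-bit numbers (under exclusive or) with index `c`. -/
def walsh (c a : Fin 8) : ℤ :=
  -- The numbers 1, 2, 4, 7 are the three-bit numbers of odd weight, so the value is (-1) to the
  -- inner product of c and a over 𝔽₂.
  if (c &&& a) = 1 ∨ (c &&& a) = 2 ∨ (c &&& a) = 4 ∨ (c &&& a) = 7 then -1 else 1

/-- The character of the block `p` by which the block `q` splits it into two halves. -/
def charIndex : Fin 15 → Fin 15 → Fin 8 := ![
  ![0, 1, 1, 1, 1, 1, 1, 1, 1, 1, 1, 1, 1, 1, 1], ![1, 0, 1, 2, 2, 2, 2, 2, 2, 2, 2, 2, 2, 2, 2],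
  ![1, 1, 0, 3, 3, 3, 3, 3, 3, 3, 3, 3, 3, 3, 3], ![2, 2, 2, 0, 1, 2, 3, 4, 4, 4, 4, 4, 4, 4, 4],
  ![2, 3, 3, 1, 0, 3, 2, 5, 5, 5, 5, 5, 5, 5, 5], ![3, 2, 3, 2, 3, 0, 1, 6, 6, 6, 6, 6, 6, 6, 6],
  ![3, 3, 2, 3, 2, 1, 0, 7, 7, 7, 7, 7, 7, 7, 7], ![4, 4, 4, 4, 4, 4, 4, 0, 3, 2, 5, 4, 7, 6, 1],
  ![5, 5, 4, 7, 7, 7, 7, 3, 0, 1, 6, 7, 4, 5, 2], ![5, 4, 5, 6, 6, 6, 6, 2, 1, 0, 7, 6, 5, 4, 3],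
  ![6, 7, 7, 5, 4, 7, 6, 5, 6, 7, 0, 1, 2, 3, 4], ![6, 6, 6, 4, 5, 6, 7, 4, 7, 6, 1, 0, 3, 2, 5],
  ![7, 7, 6, 7, 6, 5, 4, 7, 4, 5, 2, 3, 0, 1, 6], ![7, 6, 7, 6, 7, 4, 5, 6, 5, 4, 3, 2, 1, 0, 7],
  ![4, 5, 5, 5, 5, 5, 5, 1, 2, 3, 4, 5, 6, 7, 0]]

/-- The sign of a line in the block `p` with respect to the block `q`. -/
def blockChar (q p : Fin 15) (a : Fin 8) : ℤ := walsh (charIndex q p) a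

/-- `1` if the representatives of the blocks `p` and `q` are orthogonal, otherwise `-1`. -/
def repSign (p q : Fin 15) : ℤ :=
  -- Among the representatives, e_1 - e_j is orthogonal only to x_{1,j}, which comes seven places
  -- later, and to x_∅, at index 14; all other pairs have nonzero inner product.
  if ((p : ℕ) < 7 ∧ ((q : ℕ) = p + 7 ∨ (q : ℕ) = 14)) ∨
    ((q : ℕ) < 7 ∧ ((p : ℕ) = q + 7 ∨ (p : ℕ) = 14)) then 1 else -1

/-- The factor that brings the vectors of a block to norm `√8`. -/
def blockScale (p : Fin 15) : ℤ := if (p : ℕ) < 7 then 2 else 1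

/-- The finite check on which everything rests: between two frames, orthogonality is a product of
characters. The vectors have squared norm 8 after scaling, so the nonzero values ±4 mean an angle of
60° between the lines. -/
theorem scaled_dotProduct_of_lt : ∀ p q, p < q → ∀ a b,
    if repSign p q * blockChar q p a * blockChar p q b = 1 then rootVec p a ⬝ᵥ rootVec q b = 0 else
      blockScale p * blockScale q * (rootVec p a ⬝ᵥ rootVec q b) = 4 ∨
      blockScale p * blockScale q * (rootVec p a ⬝ᵥ rootVec q b) = -4 := by
  decide +kernel

theorem scaled_dotProduct_block : ∀ p a b,
    blockScale p * blockScale p * (rootVec p a ⬝ᵥ rootVec p b) = if a = b then 8 else 0 := by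
  decide +kernel

theorem walsh_eq_one_or : ∀ c a, walsh c a = 1 ∨ walsh c a = -1 := by decide +kernel

theorem walsh_xor : ∀ c a b, walsh c (a ^^^ b) = walsh c a * walsh c b := by decide +kernel

theorem walsh_zero : ∀ c, walsh c 0 = 1 := by decide +kernel

theorem sum_walsh_mul_walsh : ∀ c d, ∑ a, walsh c a * walsh d a = if c = d then 8 else 0 := by
  decide +kernel

theorem charIndex_ne_zero : ∀ q p, q ≠ p → charIndex q p ≠ 0 := by decide +kernel

theorem blockChar_eq_one_or (q p : Fin 15) (a : Fin 8) :
    blockChar q p a = 1 ∨ blockChar q p a = -1 :=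
  walsh_eq_one_or _ _

theorem blockChar_xor (q p : Fin 15) (a b : Fin 8) :
    blockChar q p (a ^^^ b) = blockChar q p a * blockChar q p b :=
  walsh_xor _ _ _

theorem blockChar_zero (q p : Fin 15) : blockChar q p 0 = 1 := walsh_zero _

theorem blockChar_mul_self (q p : Fin 15) (a : Fin 8) : blockChar q p a * blockChar q p a = 1 := by
  rcases blockChar_eq_one_or q p a with h | h <;> simp [h]

theorem sum_blockChar {q p : Fin 15} (h : q ≠ p) : ∑ a, blockChar q p a = 0 := by
  have h0 : ∀ a, walsh 0 a = 1 := by decide +kernel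
  have := sum_walsh_mul_walsh (charIndex q p) 0
  simpa [blockChar, h0, charIndex_ne_zero q p h] using this

theorem repSign_comm (p q : Fin 15) : repSign p q = repSign q p := by
  simp only [repSign, or_comm]

theorem repSign_eq_one_or (p q : Fin 15) : repSign p q = 1 ∨ repSign p q = -1 := by
  unfold repSign
  split_ifs <;> simp

theorem repSign_self (p : Fin 15) : repSign p p = -1 := by
  unfold repSign
  rw [if_neg]
  omega

/-- The sign `±1` that governs the adjacency of lines in different blocks, twisted by `ε`. -/
def pairSign (ε : Fin 15 → Fin 15 → ℤ) (x y : Fin 15 × Fin 8) : ℤ :=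
  ε x.1 y.1 * blockChar y.1 x.1 x.2 * blockChar x.1 y.1 y.2

theorem pairSign_comm {ε : Fin 15 → Fin 15 → ℤ} (hε : ∀ p q, ε p q = ε q p)
    (x y : Fin 15 × Fin 8) : pairSign ε x y = pairSign ε y x := by
  rw [pairSign, pairSign, hε]
  ring

theorem pairSign_eq_one_or {ε : Fin 15 → Fin 15 → ℤ} (hε : ∀ p q, ε p q = 1 ∨ ε p q = -1)
    (x y : Fin 15 × Fin 8) : pairSign ε x y = 1 ∨ pairSign ε x y = -1 := by
  unfold pairSign
  rcases hε x.1 y.1 with h | h <;> rcases blockChar_eq_one_or y.1 x.1 x.2 with h' | h' <;>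
    rcases blockChar_eq_one_or x.1 y.1 y.2 with h'' | h'' <;> simp [h, h', h'']

/-- The vector of a line, scaled to norm `√8`. -/
def scaledVec (x : Fin 15 × Fin 8) : Fin 8 → ℤ := blockScale x.1 • rootVec x.1 x.2

theorem scaledVec_dotProduct (x y : Fin 15 × Fin 8) :
    scaledVec x ⬝ᵥ scaledVec y =
      blockScale x.1 * blockScale y.1 * (rootVec x.1 x.2 ⬝ᵥ rootVec y.1 y.2) := by
  rw [scaledVec, scaledVec, smul_dotProduct, dotProduct_smul, smul_eq_mul, smul_eq_mul, mul_assoc]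

theorem scaledVec_dotProduct_of_eq {x y : Fin 15 × Fin 8} (h : x.1 = y.1) :
    scaledVec x ⬝ᵥ scaledVec y = if x = y then 8 else 0 := by
  obtain ⟨p, a⟩ := x
  obtain ⟨q, b⟩ := y
  obtain rfl : p = q := h
  rw [scaledVec_dotProduct, scaled_dotProduct_block]
  simp

theorem scaledVec_dotProduct_of_ne {x y : Fin 15 × Fin 8} (h : x.1 ≠ y.1) :
    (pairSign repSign x y = 1 ∧ scaledVec x ⬝ᵥ scaledVec y = 0) ∨
    (pairSign repSign x y = -1 ∧
      (scaledVec x ⬝ᵥ scaledVec y = 4 ∨ scaledVec x ⬝ᵥ scaledVec y = -4)) := by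
  wlog hlt : x.1 < y.1 generalizing x y
  · rw [pairSign_comm repSign_comm, dotProduct_comm]
    exact this h.symm (lt_of_le_of_ne (not_lt.mp hlt) h.symm)
  have key := scaled_dotProduct_of_lt x.1 y.1 hlt x.2 y.2
  rw [scaledVec_dotProduct]
  rcases pairSign_eq_one_or repSign_eq_one_or x y with hs | hs
  · left
    refine ⟨hs, ?_⟩
    rw [pairSign] at hs
    rw [if_pos hs] at key
    rw [key, mul_zero]
  · right
    refine ⟨hs, ?_⟩
    rw [pairSign] at hs
    rwa [if_neg (by rw [hs]; decide)] at key

theorem blockScale_ne_zero (p : Fin 15) : blockScale p ≠ 0 := by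
  unfold blockScale
  split_ifs <;> decide

theorem scaledVec_dotProduct_eq_zero_iff (x y : Fin 15 × Fin 8) :
    scaledVec x ⬝ᵥ scaledVec y = 0 ↔
      (x.1 = y.1 ∧ x ≠ y) ∨ (x.1 ≠ y.1 ∧ pairSign repSign x y = 1) := by
  by_cases h : x.1 = y.1
  · rw [scaledVec_dotProduct_of_eq h]
    by_cases hxy : x = y <;> simp [h, hxy]
  · rcases scaledVec_dotProduct_of_ne h with ⟨h1, h2⟩ | ⟨h1, h2 | h2⟩ <;> simp [h, h1, h2]

/-! ### Graphs on the pairs (block, line) -/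

/-- Blocks are cliques, and lines in different blocks are adjacent iff their sign is `1`. -/
def signGraph (ε : Fin 15 → Fin 15 → ℤ) (hε : ∀ p q, ε p q = ε q p) :
    SimpleGraph (Fin 15 × Fin 8) where
  Adj x y := (x.1 = y.1 ∧ x ≠ y) ∨ (x.1 ≠ y.1 ∧ pairSign ε x y = 1)
  symm := ⟨fun x y h => by
    rwa [pairSign_comm hε, eq_comm (a := y.1), ne_comm (a := y), ne_comm (a := y.1)]⟩
  loopless := ⟨fun x h => by simp at h⟩

/-- The line with a given block and number. -/
def line (x : Fin 15 × Fin 8) : E8Line := ⟦⟨toReal (rootVec x.1 x.2), toReal_rootVec_mem _ _⟩⟧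

theorem e8Graph_adj_line (x y : Fin 15 × Fin 8) :
    e8Graph.Adj (line x) (line y) ↔ (signGraph repSign repSign_comm).Adj x y := by
  change toReal _ ⬝ᵥ toReal _ = 0 ↔ _
  rw [toReal_dotProduct, Int.cast_eq_zero]
  refine Iff.trans ?_ (scaledVec_dotProduct_eq_zero_iff x y)
  simp [scaledVec_dotProduct, blockScale_ne_zero]

/-- Equal lines have equal neighbourhoods. In one block, adjacency of distinct labels would make a
vertex its own neighbour. For different blocks, y would be adjacent to the seven lines other than x
in the block of x, whereas the signs of y on that block sum to 0. -/
theorem line_injective : Function.Injective line := by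
  intro x y hxy
  by_contra hne
  have hadj : ∀ z, (signGraph repSign repSign_comm).Adj x z ↔
      (signGraph repSign repSign_comm).Adj y z := fun z => by
    rw [← e8Graph_adj_line, hxy, e8Graph_adj_line]
  by_cases hb : x.1 = y.1
  · exact (signGraph repSign repSign_comm).loopless.irrefl y ((hadj y).1 (.inl ⟨hb, hne⟩))
  · have hyx : y.1 ≠ x.1 := Ne.symm hb
    have hone : ∀ c, c ≠ x.2 → pairSign repSign y (x.1, c) = 1 := fun c hc => by
      have := (hadj (x.1, c)).1 (.inl ⟨rfl, fun h => hc (by rw [h])⟩)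
      simpa [signGraph, hyx] using this
    have hsum : ∑ c, pairSign repSign y (x.1, c) = 0 := by
      simp [pairSign, ← Finset.mul_sum, sum_blockChar hyx]
    rw [← Finset.add_sum_erase _ _ (Finset.mem_univ x.2),
      Finset.sum_congr rfl (fun c hc => hone c (Finset.ne_of_mem_erase hc))] at hsum
    rcases pairSign_eq_one_or repSign_eq_one_or y (x.1, x.2) with h | h <;>
      simp [h] at hsum

theorem line_surjective : Function.Surjective line := by
  rintro ⟨⟨x, hx⟩⟩
  obtain ⟨k, a, h⟩ := exists_rootVec_of_mem_e8Roots hx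
  refine ⟨(k, a), Quotient.sound ?_⟩
  rcases h with rfl | rfl
  · exact .inl rfl
  · exact .inr (neg_neg _).symm

/-- The numbering of the lines. -/
noncomputable def lineEquiv : Fin 15 × Fin 8 ≃ E8Line :=
  Equiv.ofBijective line ⟨line_injective, line_surjective⟩

theorem lineEquiv_mem_e8Block {x : Fin 15 × Fin 8} {k : Fin 15} :
    lineEquiv x ∈ e8Block k ↔ x.1 = k := by
  constructor
  · rintro ⟨⟨y, hy⟩, hmem, hxy⟩
    obtain ⟨a, rfl⟩ := mem_blockVectors.1 hmem
    have : line x = line (k, a) := hxy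
    rw [line_injective this]
  · rintro rfl
    exact ⟨_, mem_blockVectors.2 ⟨x.2, rfl⟩, rfl⟩

theorem e8Graph_adj {x y : Fin 15 × Fin 8} :
    e8Graph.Adj (lineEquiv x) (lineEquiv y) ↔ (signGraph repSign repSign_comm).Adj x y :=
  e8Graph_adj_line x y

theorem e8Reps_dotProduct_eq_zero_iff (p q : Fin 15) :
    e8Reps p ⬝ᵥ e8Reps q = 0 ↔ repSign p q = 1 := by
  have h := scaledVec_dotProduct_eq_zero_iff (p, 0) (q, 0)
  rw [e8Reps_eq, e8Reps_eq, toReal_dotProduct, Int.cast_eq_zero]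
  rw [scaledVec_dotProduct, mul_eq_zero, or_iff_right (mul_ne_zero (blockScale_ne_zero _)
    (blockScale_ne_zero _))] at h
  rw [h]
  by_cases hpq : p = q
  · subst hpq
    simp [repSign_self]
  · simp [hpq, pairSign, blockChar_zero]

/-- Complementing exactly where `repSign` is 1 turns every sign between different blocks into -1. -/
theorem e8TwistedGraph_adj {x y : Fin 15 × Fin 8} :
    e8TwistedGraph.Adj (lineEquiv x) (lineEquiv y) ↔
      (signGraph (fun _ _ => -1) fun _ _ => rfl).Adj x y := by
  have : e8TwistedGraph.Adj (lineEquiv x) (lineEquiv y) ↔ x ≠ y ∧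
      ((repSign x.1 y.1 ≠ 1 ∧ (signGraph repSign repSign_comm).Adj x y) ∨
      (repSign x.1 y.1 = 1 ∧ ¬ (signGraph repSign repSign_comm).Adj x y)) := by
    simp only [e8TwistedGraph, twistedGraph, lineEquiv_mem_e8Block, e8Reps_dotProduct_eq_zero_iff,
      e8Graph_adj, ne_eq, EmbeddingLike.apply_eq_iff_eq]
    simp
  rw [this]
  obtain ⟨p, a⟩ := x
  obtain ⟨q, b⟩ := y
  by_cases hpq : p = q
  · subst hpq
    simp [signGraph, repSign_self]
  · rcases repSign_eq_one_or p q with h | h <;> rcases blockChar_eq_one_or q p a with h' | h' <;>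
      rcases blockChar_eq_one_or p q b with h'' | h'' <;>
      simp [signGraph, pairSign, hpq, h, h', h'']

/-! ### Godsil-McKay switching in coordinates -/

theorem card_filter_eq_one_of_sum_eq_zero {f : Fin 8 → ℤ} (hf : ∀ a, f a = 1 ∨ f a = -1)
    (h : ∑ a, f a = 0) : (Finset.univ.filter fun a => f a = 1).card = 4 := by
  have key : ∀ a, 1 + f a = 2 * if f a = 1 then 1 else 0 := fun a => by
    rcases hf a with h | h <;> simp [h]
  have hsum : ∑ a, (1 + f a) = 8 := by simp [Finset.sum_add_distrib, h]
  rw [Finset.sum_congr rfl fun a _ => key a, ← Finset.mul_sum, Finset.sum_boole] at hsum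
  have : (2 * (Finset.univ.filter fun a => f a = 1).card : ℤ) = 8 := by exact_mod_cast hsum
  omega

theorem sum_pairSign {ε : Fin 15 → Fin 15 → ℤ} {x : Fin 15 × Fin 8} {q : Fin 15} (h : x.1 ≠ q) :
    ∑ c, pairSign ε x (q, c) = 0 := by
  simp [pairSign, ← Finset.mul_sum, sum_blockChar h]

theorem inter_e8Block_eq_image (S : Set E8Line) (q : Fin 15) :
    S ∩ e8Block q = (fun c => lineEquiv (q, c)) '' {c | lineEquiv (q, c) ∈ S} := by
  ext v
  obtain ⟨⟨p, a⟩, rfl⟩ := lineEquiv.surjective v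
  simp only [Set.mem_inter_iff, lineEquiv_mem_e8Block, Set.mem_image, Set.mem_ofPred_eq,
    EmbeddingLike.apply_eq_iff_eq, Prod.mk.injEq]
  constructor
  · rintro ⟨h, rfl⟩
    exact ⟨a, h, rfl, rfl⟩
  · rintro ⟨c, h, rfl, rfl⟩
    exact ⟨h, rfl⟩

theorem ncard_inter_e8Block (S : Set E8Line) (q : Fin 15) :
    (S ∩ e8Block q).ncard = {c | lineEquiv (q, c) ∈ S}.ncard := by
  rw [inter_e8Block_eq_image, Set.ncard_image_of_injective]
  intro c d h
  simpa using h

theorem ncard_e8Block (k : Fin 15) : (e8Block k).ncard = 8 := by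
  rw [← Set.univ_inter (e8Block k), ncard_inter_e8Block]
  simp

section

variable {G : SimpleGraph E8Line} {ε : Fin 15 → Fin 15 → ℤ} {hε : ∀ p q, ε p q = ε q p}

/-- As a function of the line in block j, the sign is ± a nontrivial character; it sums to 0 and
therefore equals 1 four times. -/
theorem ncard_neighborSet_inter_of_ne
    (hG : ∀ x y, G.Adj (lineEquiv x) (lineEquiv y) ↔ (signGraph ε hε).Adj x y)
    (hs : ∀ p q, ε p q = 1 ∨ ε p q = -1) {i j : Fin 15} (hij : i ≠ j) {v : E8Line}
    (hv : v ∈ e8Block i) : (G.neighborSet v ∩ e8Block j).ncard = 4 := by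
  obtain ⟨x, rfl⟩ := lineEquiv.surjective v
  obtain rfl := lineEquiv_mem_e8Block.1 hv
  rw [ncard_inter_e8Block]
  simp only [SimpleGraph.mem_neighborSet, hG, signGraph, hij, false_and, not_false_eq_true,
    true_and, ne_eq, false_or]
  rw [← card_filter_eq_one_of_sum_eq_zero (fun c => pairSign_eq_one_or hs x (j, c))
    (sum_pairSign hij), ← Set.ncard_coe_finset]
  simp

theorem ncard_neighborSet_inter_self
    (hG : ∀ x y, G.Adj (lineEquiv x) (lineEquiv y) ↔ (signGraph ε hε).Adj x y)
    {i : Fin 15} {v : E8Line} (hv : v ∈ e8Block i) : (G.neighborSet v ∩ e8Block i).ncard = 7 := by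
  obtain ⟨⟨p, a⟩, rfl⟩ := lineEquiv.surjective v
  obtain rfl : p = i := lineEquiv_mem_e8Block.1 hv
  rw [ncard_inter_e8Block]
  have : {c | lineEquiv (p, c) ∈ G.neighborSet (lineEquiv (p, a))} =
      ((Finset.univ.erase a : Finset (Fin 8)) : Set (Fin 8)) := by
    ext c
    simp [hG, signGraph, eq_comm]
  rw [this, Set.ncard_coe_finset]
  simp

theorem gmPartition_of_signGraph
    (hG : ∀ x y, G.Adj (lineEquiv x) (lineEquiv y) ↔ (signGraph ε hε).Adj x y)
    (hs : ∀ p q, ε p q = 1 ∨ ε p q = -1) : GMPartition G e8Cells e8Special where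
  nonempty i := ⟨lineEquiv (i.castSucc, 0), lineEquiv_mem_e8Block.2 rfl⟩
  nonempty_D := ⟨lineEquiv (Fin.last 14, 0), lineEquiv_mem_e8Block.2 rfl⟩
  disjoint i j hij := Set.disjoint_left.2 fun v hi hj => by
    obtain ⟨x, rfl⟩ := lineEquiv.surjective v
    rw [e8Cells, lineEquiv_mem_e8Block] at hi hj
    exact hij (Fin.castSucc_injective _ (hi.symm.trans hj))
  disjoint_D i := Set.disjoint_left.2 fun v hi hj => by
    obtain ⟨x, rfl⟩ := lineEquiv.surjective v
    rw [e8Cells, lineEquiv_mem_e8Block] at hi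
    rw [e8Special, lineEquiv_mem_e8Block] at hj
    exact Fin.castSucc_ne_last i (hi.symm.trans hj)
  cover := Set.eq_univ_of_forall fun v => by
    obtain ⟨⟨p, a⟩, rfl⟩ := lineEquiv.surjective v
    rcases Fin.eq_castSucc_or_eq_last p with ⟨i, rfl⟩ | rfl
    · exact .inl (Set.mem_iUnion.2 ⟨i, lineEquiv_mem_e8Block.2 rfl⟩)
    · exact .inr (lineEquiv_mem_e8Block.2 rfl)
  equitable i j u hu v hv := by
    by_cases hij : i = j
    · subst hij
      exact (ncard_neighborSet_inter_self hG hu).trans (ncard_neighborSet_inter_self hG hv).symm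
    · have hij' : i.castSucc ≠ j.castSucc := fun h => hij (Fin.castSucc_injective _ h)
      exact (ncard_neighborSet_inter_of_ne hG hs hij' hu).trans
        (ncard_neighborSet_inter_of_ne hG hs hij' hv).symm
  zero_half_all v hv i := .inr <| .inl <| by
    rw [e8Cells, ncard_neighborSet_inter_of_ne hG hs (Fin.castSucc_ne_last i).symm hv,
      ncard_e8Block]

/-- The signs of the switched graph. -/
def switchSign (ε : Fin 15 → Fin 15 → ℤ) (p q : Fin 15) : ℤ :=
  if p = Fin.last 14 ↔ q = Fin.last 14 then ε p q else -ε p q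

theorem switchSign_comm (hε : ∀ p q, ε p q = ε q p) (p q : Fin 15) :
    switchSign ε p q = switchSign ε q p := by
  rw [switchSign, switchSign, hε]
  exact if_congr iff_comm rfl rfl

theorem switchSign_eq_one_or (hs : ∀ p q, ε p q = 1 ∨ ε p q = -1) (p q : Fin 15) :
    switchSign ε p q = 1 ∨ switchSign ε p q = -1 := by
  unfold switchSign
  rcases hs p q with h | h <;> split_ifs <;> simp [h]

theorem gmToggled_iff
    (hG : ∀ x y, G.Adj (lineEquiv x) (lineEquiv y) ↔ (signGraph ε hε).Adj x y)
    (hs : ∀ p q, ε p q = 1 ∨ ε p q = -1) (x y : Fin 15 × Fin 8) :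
    GMToggled G e8Cells e8Special (lineEquiv x) (lineEquiv y) ↔
      x.1 = Fin.last 14 ∧ y.1 ≠ Fin.last 14 := by
  rw [GMToggled, e8Special, lineEquiv_mem_e8Block]
  refine and_congr_right fun hx => ?_
  constructor
  · rintro ⟨i, hi, -⟩
    rw [e8Cells, lineEquiv_mem_e8Block] at hi
    rw [hi]
    exact Fin.castSucc_ne_last i
  · intro hy
    obtain ⟨i, hi⟩ := (Fin.eq_castSucc_or_eq_last y.1).resolve_right hy
    refine ⟨i, lineEquiv_mem_e8Block.2 hi, ?_⟩
    rw [e8Cells, ncard_neighborSet_inter_of_ne hG hs (i := Fin.last 14)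
      (Fin.castSucc_ne_last i).symm (lineEquiv_mem_e8Block.2 hx), ncard_e8Block]

/-- Every vertex of V_15 has exactly half of each other block as neighbours, so all pairs between
V_15 and the other blocks are toggled, and toggling is negation of the sign. -/
theorem gmSwitch_adj
    (hG : ∀ x y, G.Adj (lineEquiv x) (lineEquiv y) ↔ (signGraph ε hε).Adj x y)
    (hs : ∀ p q, ε p q = 1 ∨ ε p q = -1) (x y : Fin 15 × Fin 8) :
    (gmSwitch G e8Cells e8Special).Adj (lineEquiv x) (lineEquiv y) ↔
      (signGraph (switchSign ε) (switchSign_comm hε)).Adj x y := by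
  simp only [gmSwitch, gmToggled_iff hG hs, hG, ne_eq, EmbeddingLike.apply_eq_iff_eq]
  by_cases hxy : x.1 = y.1
  · simp [signGraph, hxy]
  · have hne : x ≠ y := fun h => hxy (by rw [h])
    have hcases := pairSign_eq_one_or hs x y
    have hflip : pairSign (switchSign ε) x y =
        if x.1 = Fin.last 14 ↔ y.1 = Fin.last 14 then pairSign ε x y else -pairSign ε x y := by
      simp only [pairSign, switchSign]
      split_ifs <;> ring
    by_cases h1 : x.1 = Fin.last 14 <;> by_cases h2 : y.1 = Fin.last 14 <;>
      rcases hcases with h | h <;> simp_all [signGraph]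

end

theorem switchedE8Graph_adj (x y : Fin 15 × Fin 8) :
    switchedE8Graph.Adj (lineEquiv x) (lineEquiv y) ↔
      (signGraph (switchSign repSign) (switchSign_comm repSign_comm)).Adj x y :=
  gmSwitch_adj (fun _ _ => e8Graph_adj) repSign_eq_one_or x y

theorem switchedTwistedGraph_adj (x y : Fin 15 × Fin 8) :
    switchedTwistedGraph.Adj (lineEquiv x) (lineEquiv y) ↔
      (signGraph (switchSign fun _ _ => -1) (switchSign_comm fun _ _ => rfl)).Adj x y :=
  gmSwitch_adj (fun _ _ => e8TwistedGraph_adj) (fun _ _ => .inr rfl) x y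

/-! ### Strong regularity -/

/-- The number of the point of `PG(3, 2)` that belongs to a block. -/
def blockPoint (k : Fin 15) : ℕ := if (k : ℕ) < 7 then k + 1 else if (k : ℕ) = 14 then 8 else k + 2

/-- The block of the third point on the line through the points of two blocks. -/
def thirdBlock (p q : Fin 15) : Fin 15 :=
  let n := blockPoint p ^^^ blockPoint q
  -- This inverts `blockPoint` on the nonzero four-bit numbers. For p = q it returns a junk value,
  -- excluded wherever the definition is used.
  Fin.ofNat 15 (if n < 8 then n - 1 else if n = 8 then 14 else n - 2)

/-- On a block the seven nontrivial characters correspond to the seven projective lines through its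
point, each character coming from the two other points of the line. -/
theorem thirdBlock_spec : ∀ p q, p ≠ q →
    thirdBlock p q ≠ p ∧ thirdBlock p q ≠ q ∧
    charIndex (thirdBlock p q) p = charIndex q p ∧ charIndex (thirdBlock p q) q = charIndex p q ∧
    ∀ r, r ≠ p → r ≠ q → (charIndex p r = charIndex q r ↔ r = thirdBlock p q) := by
  decide +kernel

/-- Each nontrivial character of block p arises from two blocks r, and the seven of them sum to -1
at the nonzero element a xor b. -/
theorem sum_blockChar_mul_blockChar : ∀ p a b, a ≠ b →
    ∑ r, (if r = p then 0 else blockChar r p a * blockChar r p b) = -2 := by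
  decide +kernel

theorem repSign_mul_thirdBlock : ∀ p q, p ≠ q →
    repSign p (thirdBlock p q) * repSign q (thirdBlock p q) = -repSign p q := by
  decide +kernel

/-- Switching negates two of the three pairs on a projective line through the point of V_15 and none
on any other line, so the product over a line is unchanged. -/
theorem switchSign_mul_thirdBlock {ε : Fin 15 → Fin 15 → ℤ}
    (hl : ∀ p q, p ≠ q → ε p (thirdBlock p q) * ε q (thirdBlock p q) = -ε p q)
    (p q : Fin 15) (hpq : p ≠ q) :
    switchSign ε p (thirdBlock p q) * switchSign ε q (thirdBlock p q) = -switchSign ε p q := by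
  have h := hl p q hpq
  obtain ⟨h1, h2, -⟩ := thirdBlock_spec p q hpq
  unfold switchSign
  by_cases hp : p = Fin.last 14 <;> by_cases hq : q = Fin.last 14 <;>
    by_cases hr : thirdBlock p q = Fin.last 14 <;> simp_all

section

open Classical

variable {ε : Fin 15 → Fin 15 → ℤ} {hε : ∀ p q, ε p q = ε q p}

/-- Twice the adjacency matrix. -/
noncomputable def twiceAdj (ε : Fin 15 → Fin 15 → ℤ) (hε : ∀ p q, ε p q = ε q p)
    (x y : Fin 15 × Fin 8) : ℤ :=
  2 * if (signGraph ε hε).Adj x y then 1 else 0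

theorem twiceAdj_of_ne (hs : ∀ p q, ε p q = 1 ∨ ε p q = -1) {x y : Fin 15 × Fin 8}
    (h : x.1 ≠ y.1) : twiceAdj ε hε x y = 1 + pairSign ε x y := by
  rcases pairSign_eq_one_or hs x y with hp | hp <;> simp [twiceAdj, signGraph, h, hp]

theorem twiceAdj_self (p : Fin 15) (a c : Fin 8) :
    twiceAdj ε hε (p, a) (p, c) = 2 - if a = c then 2 else 0 := by
  by_cases h : a = c <;> simp [twiceAdj, signGraph, h]

theorem sum_twiceAdj_self (p : Fin 15) (a : Fin 8) (f : Fin 8 → ℤ) :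
    ∑ c, twiceAdj ε hε (p, a) (p, c) * f c = 2 * ∑ c, f c - 2 * f a := by
  simp [twiceAdj_self, sub_mul, Finset.sum_sub_distrib, Finset.mul_sum]

theorem sum_one_add_pairSign {x : Fin 15 × Fin 8} {q : Fin 15} (h : x.1 ≠ q) :
    ∑ c, (1 + pairSign ε x (q, c)) = 8 := by
  simp [Finset.sum_add_distrib, sum_pairSign h]

theorem sum_twiceAdj (hs : ∀ p q, ε p q = 1 ∨ ε p q = -1) (x : Fin 15 × Fin 8) :
    ∑ z, twiceAdj ε hε x z = 126 := by
  obtain ⟨p, a⟩ := x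
  have key : ∀ r, ∑ c, twiceAdj ε hε (p, a) (r, c) = 8 + if r = p then 6 else 0 := fun r => by
    by_cases hr : r = p
    · subst hr
      simpa using sum_twiceAdj_self (hε := hε) r a fun _ => 1
    · rw [Finset.sum_congr rfl fun c _ => twiceAdj_of_ne hs (x := (p, a)) (y := (r, c)) (Ne.symm hr),
        sum_one_add_pairSign (x := (p, a)) (Ne.symm hr)]
      simp [hr]
  rw [Fintype.sum_prod_type, Finset.sum_congr rfl fun r _ => key r]
  simp [Finset.sum_add_distrib]

/-- Expanding (1 + s)(1 + t), the linear terms sum to 0, and the product of the two characters on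
block r survives only if they are equal. -/
theorem sum_mul_of_ne (hs : ∀ p q, ε p q = 1 ∨ ε p q = -1) {p q r : Fin 15} (a b : Fin 8)
    (hp : p ≠ r) (hq : q ≠ r) :
    ∑ c, twiceAdj ε hε (p, a) (r, c) * twiceAdj ε hε (q, b) (r, c) =
      8 + (ε p r * ε q r) * (blockChar r p a * blockChar r q b) *
        if charIndex p r = charIndex q r then 8 else 0 := by
  rw [← sum_walsh_mul_walsh, Finset.mul_sum]
  have key : ∀ c, twiceAdj ε hε (p, a) (r, c) * twiceAdj ε hε (q, b) (r, c) =
      (1 + pairSign ε (p, a) (r, c)) + pairSign ε (q, b) (r, c) +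
      (ε p r * ε q r) * (blockChar r p a * blockChar r q b) *
        (walsh (charIndex p r) c * walsh (charIndex q r) c) := fun c => by
    rw [twiceAdj_of_ne hs (by exact hp), twiceAdj_of_ne hs (by exact hq)]
    simp only [pairSign, blockChar]
    ring
  rw [Finset.sum_congr rfl fun c _ => key c, Finset.sum_add_distrib, Finset.sum_add_distrib,
    sum_one_add_pairSign (x := (p, a)) hp, sum_pairSign (x := (q, b)) hq, add_zero]

theorem sum_twiceAdj_mul_of_eq (hs : ∀ p q, ε p q = 1 ∨ ε p q = -1) (p : Fin 15) {a b : Fin 8}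
    (hab : a ≠ b) : ∑ z, twiceAdj ε hε (p, a) z * twiceAdj ε hε (p, b) z = 120 := by
  have key : ∀ r, ∑ c, twiceAdj ε hε (p, a) (r, c) * twiceAdj ε hε (p, b) (r, c) =
      8 + (if r = p then 16 else 0) +
        8 * if r = p then 0 else blockChar r p a * blockChar r p b := fun r => by
    by_cases hr : r = p
    · subst hr
      rw [sum_twiceAdj_self]
      have := sum_twiceAdj_self (hε := hε) r b fun _ => 1
      simp only [mul_one, Finset.sum_const, Finset.card_univ, Fintype.card_fin] at this
      rw [this, twiceAdj_self]
      simp [hab.symm]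
    · have hee : ε p r * ε p r = 1 := by rcases hs p r with h | h <;> simp [h]
      rw [sum_mul_of_ne hs a b (Ne.symm hr) (Ne.symm hr), hee]
      simp [hr]
      ring
  rw [Fintype.sum_prod_type, Finset.sum_congr rfl fun r _ => key r, Finset.sum_add_distrib,
    Finset.sum_add_distrib, ← Finset.mul_sum, sum_blockChar_mul_blockChar p a b hab]
  simp

theorem sum_twiceAdj_mul_of_ne (hs : ∀ p q, ε p q = 1 ∨ ε p q = -1)
    (hl : ∀ p q, p ≠ q → ε p (thirdBlock p q) * ε q (thirdBlock p q) = -ε p q)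
    {p q : Fin 15} (hpq : p ≠ q) (a b : Fin 8) :
    ∑ z, twiceAdj ε hε (p, a) z * twiceAdj ε hε (q, b) z =
      132 - 12 * pairSign ε (p, a) (q, b) := by
  obtain ⟨hrp, hrq, hcp, hcq, hiff⟩ := thirdBlock_spec p q hpq
  have hself : ∀ p q a b, p ≠ q →
      ∑ c, twiceAdj ε hε (p, a) (p, c) * twiceAdj ε hε (q, b) (p, c) =
        14 - 2 * pairSign ε (p, a) (q, b) := fun p q a b hpq => by
    rw [sum_twiceAdj_self, Finset.sum_congr rfl fun c _ =>
      twiceAdj_of_ne hs (x := (q, b)) (y := (p, c)) hpq.symm, sum_one_add_pairSign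
      (x := (q, b)) hpq.symm, twiceAdj_of_ne hs (x := (q, b)) hpq.symm, pairSign_comm hε]
    ring
  have key : ∀ r, ∑ c, twiceAdj ε hε (p, a) (r, c) * twiceAdj ε hε (q, b) (r, c) =
      8 + (if r = p then 6 - 2 * pairSign ε (p, a) (q, b) else 0) +
        (if r = q then 6 - 2 * pairSign ε (p, a) (q, b) else 0) +
        if r = thirdBlock p q then -8 * pairSign ε (p, a) (q, b) else 0 := fun r => by
    by_cases h1 : r = p
    · subst h1
      rw [hself r q a b hpq]
      simp [hpq, hrp.symm]
      ring
    by_cases h2 : r = q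
    · subst h2
      simp_rw [mul_comm (twiceAdj ε hε (p, a) _)]
      rw [hself r p b a hpq.symm, pairSign_comm hε]
      simp [hpq.symm, hrq.symm]
      ring
    rw [sum_mul_of_ne hs a b (Ne.symm h1) (Ne.symm h2)]
    by_cases h3 : r = thirdBlock p q
    · rw [if_pos ((hiff r h1 h2).2 h3), if_neg h1, if_neg h2, if_pos h3, h3, hl p q hpq]
      simp only [pairSign, blockChar, hcp, hcq]
      ring
    · rw [if_neg (mt (hiff r h1 h2).1 h3), if_neg h1, if_neg h2, if_neg h3]
      ring
  rw [Fintype.sum_prod_type, Finset.sum_congr rfl fun r _ => key r]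
  simp only [Finset.sum_add_distrib, Finset.sum_ite_eq', Finset.mem_univ, if_true, Finset.sum_const,
    Finset.card_univ, Fintype.card_fin]
  ring

theorem isSRGWith_of_signGraph {G : SimpleGraph E8Line}
    (hG : ∀ x y, G.Adj (lineEquiv x) (lineEquiv y) ↔ (signGraph ε hε).Adj x y)
    (hs : ∀ p q, ε p q = 1 ∨ ε p q = -1)
    (hl : ∀ p q, p ≠ q → ε p (thirdBlock p q) * ε q (thirdBlock p q) = -ε p q) :
    G.IsSRGWith 120 63 30 36 := by
  -- Each common neighbour counts four, so the values 120 and 132 ∓ 12 found above give 30 and 36.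
  have hcommon : ∀ x y, (4 * Fintype.card (G.commonNeighbors (lineEquiv x) (lineEquiv y)) : ℤ) =
      ∑ z, twiceAdj ε hε x z * twiceAdj ε hε y z := fun x y => by
    have hmul : ∀ z, twiceAdj ε hε x z * twiceAdj ε hε y z =
        4 * if (signGraph ε hε).Adj x z ∧ (signGraph ε hε).Adj y z then 1 else 0 := fun z => by
      by_cases h1 : (signGraph ε hε).Adj x z <;> by_cases h2 : (signGraph ε hε).Adj y z <;>
        simp [twiceAdj, h1, h2]
    rw [Finset.sum_congr rfl fun z _ => hmul z, ← Finset.mul_sum, Finset.sum_boole,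
      ← Fintype.card_subtype]
    congr 2
    refine Fintype.card_congr (lineEquiv.subtypeEquiv fun z => ?_).symm
    simp [SimpleGraph.mem_commonNeighbors, hG]
  refine ⟨?_, fun v => ?_, fun v w hvw => ?_, fun v w hne hvw => ?_⟩
  · rw [Fintype.card_congr lineEquiv.symm]
    simp
  · obtain ⟨x, rfl⟩ := lineEquiv.surjective v
    have h := sum_twiceAdj (hε := hε) hs x
    simp only [twiceAdj] at h
    rw [← Finset.mul_sum, Finset.sum_boole, ← Fintype.card_subtype] at h
    rw [← SimpleGraph.card_neighborSet_eq_degree,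
      Fintype.card_congr (lineEquiv.subtypeEquiv (p := fun z => (signGraph ε hε).Adj x z)
        fun z => by simp [hG]).symm]
    omega
  · obtain ⟨⟨p, a⟩, rfl⟩ := lineEquiv.surjective v
    obtain ⟨⟨q, b⟩, rfl⟩ := lineEquiv.surjective w
    have h := hcommon (p, a) (q, b)
    rw [hG] at hvw
    rcases hvw with ⟨hpq, hne⟩ | ⟨hpq, h1⟩
    · obtain rfl : p = q := hpq
      rw [sum_twiceAdj_mul_of_eq hs p (by simpa using hne)] at h
      omega
    · rw [sum_twiceAdj_mul_of_ne hs hl hpq, h1] at h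
      omega
  · obtain ⟨⟨p, a⟩, rfl⟩ := lineEquiv.surjective v
    obtain ⟨⟨q, b⟩, rfl⟩ := lineEquiv.surjective w
    have h := hcommon (p, a) (q, b)
    rw [hG] at hvw
    have hpq : p ≠ q := fun hpq => hvw (.inl ⟨hpq, fun h => hne (by rw [h])⟩)
    have h1 := (pairSign_eq_one_or hs (p, a) (q, b)).resolve_left fun h1 => hvw (.inr ⟨hpq, h1⟩)
    rw [sum_twiceAdj_mul_of_ne hs hl hpq, h1] at h
    omega

end

/-! ### Quantum isomorphism -/

/-- The matrix whose rows are the scaled vectors of the lines of a block. -/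
def blockMatrix (p : Fin 15) : Matrix (Fin 8) (Fin 8) ℂ := of fun a i => (scaledVec (p, a) i : ℂ)

/-- The orthogonal projection onto a line. -/
noncomputable def lineProj (x : Fin 15 × Fin 8) : Matrix (Fin 8) (Fin 8) ℂ :=
  of fun i j => (1 / 8 : ℂ) * (scaledVec x i * scaledVec x j)

theorem blockMatrix_mul_transpose_apply (p q : Fin 15) (a b : Fin 8) :
    (blockMatrix p * (blockMatrix q)ᵀ) a b = ((scaledVec (p, a) ⬝ᵥ scaledVec (q, b) : ℤ) : ℂ) := by
  simp [blockMatrix, mul_apply, dotProduct]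

theorem blockMatrix_mul_transpose (p : Fin 15) :
    blockMatrix p * (blockMatrix p)ᵀ = (8 : ℂ) • 1 := by
  ext a b
  rw [blockMatrix_mul_transpose_apply,
    scaledVec_dotProduct_of_eq (x := (p, a)) (y := (p, b)) rfl]
  by_cases h : a = b <;> simp [h, one_apply]

theorem transpose_mul_blockMatrix (p : Fin 15) :
    (blockMatrix p)ᵀ * blockMatrix p = (8 : ℂ) • 1 := by
  have h : ((1 / 8 : ℂ) • blockMatrix p) * (blockMatrix p)ᵀ = 1 := by
    rw [Matrix.smul_mul, blockMatrix_mul_transpose, smul_smul]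
    norm_num
  have h' := mul_eq_one_comm.1 h
  rw [Matrix.mul_smul] at h'
  rw [← h', smul_smul]
  norm_num

theorem sum_smul_lineProj (p : Fin 15) (f : Fin 8 → ℤ) :
    ∑ a, f a • lineProj (p, a) =
      (1 / 8 : ℂ) • ((blockMatrix p)ᵀ * diagonal (fun a => (f a : ℂ)) * blockMatrix p) := by
  ext i j
  rw [Matrix.sum_apply, Matrix.smul_apply, mul_apply, smul_eq_mul, Finset.mul_sum]
  simp only [Matrix.smul_apply, mul_diagonal, lineProj, blockMatrix, of_apply, transpose_apply]
  simp only [zsmul_eq_mul]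
  exact Finset.sum_congr rfl fun a _ => by ring

theorem sum_lineProj (p : Fin 15) : ∑ a, lineProj (p, a) = 1 := by
  have h := sum_smul_lineProj p fun _ => 1
  simp only [one_smul, Int.cast_one, diagonal_one, mul_one, transpose_mul_blockMatrix,
    smul_smul] at h
  rw [h]
  norm_num

theorem isStarProjection_lineProj (x : Fin 15 × Fin 8) : IsStarProjection (lineProj x) := by
  refine ⟨?_, ?_⟩
  · ext i j
    have h : ∑ k, (scaledVec x k : ℂ) * scaledVec x k = 8 := by
      have := scaledVec_dotProduct_of_eq (x := x) (y := x) rfl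
      rw [if_pos rfl, dotProduct] at this
      exact_mod_cast this
    calc (lineProj x * lineProj x) i j
        = ∑ k, (1 / 64 : ℂ) * (scaledVec x i * scaledVec x j) *
            ((scaledVec x k : ℂ) * scaledVec x k) := by
          simp only [lineProj, mul_apply, of_apply]
          exact Finset.sum_congr rfl fun k _ => by ring
      _ = lineProj x i j := by
          rw [← Finset.mul_sum, h, lineProj, of_apply]
          ring
  · ext i j
    simp [lineProj, star_apply, mul_comm]

/-- Lines (p, a) and (q, b) that are not orthogonal satisfy χ(a) = -ε(p,q) χ'(b). Hence each
eigenspace of the left symmetry is orthogonal to the non-matching eigenspace of the right one, and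
the two symmetries coincide. -/
theorem sum_blockChar_smul_lineProj {p q : Fin 15} (hpq : p ≠ q) :
    ∑ a, blockChar q p a • lineProj (p, a) =
      (-repSign p q) • ∑ b, blockChar p q b • lineProj (q, b) := by
  set D : Matrix (Fin 8) (Fin 8) ℂ := diagonal fun a => (blockChar q p a : ℂ) with hD
  set E : Matrix (Fin 8) (Fin 8) ℂ := diagonal fun b => (blockChar p q b : ℂ) with hE
  have hcomm : D * (blockMatrix p * (blockMatrix q)ᵀ) =
      (-repSign p q) • (blockMatrix p * (blockMatrix q)ᵀ * E) := by
    ext a b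
    rw [Matrix.smul_apply, hD, hE, diagonal_mul, mul_diagonal, blockMatrix_mul_transpose_apply,
      zsmul_eq_mul]
    norm_cast
    rcases scaledVec_dotProduct_of_ne (x := (p, a)) (y := (q, b)) hpq with ⟨-, h⟩ | ⟨h, -⟩
    · simp [h]
    · simp only [pairSign] at h
      have h1 := blockChar_mul_self p q b
      have h2 : repSign p q * repSign p q = 1 := by
        rcases repSign_eq_one_or p q with h | h <;> simp [h]
      have h3 : blockChar q p a = -repSign p q * blockChar p q b := by
        linear_combination repSign p q * blockChar p q b * h - blockChar q p a * h1 -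
          blockChar q p a * (blockChar p q b * blockChar p q b) * h2
      rw [h3]
      ring
  -- Multiplying by the frame matrices and using that each transpose times its matrix is 8 turns the
  -- entrywise relation into the operator identity.
  have h := congrArg (fun X => (blockMatrix p)ᵀ * X * blockMatrix q) hcomm
  simp only [Matrix.mul_smul, Matrix.smul_mul] at h
  rw [sum_smul_lineProj, sum_smul_lineProj, ← hD, ← hE, smul_comm]
  congr 1
  have e1 : (blockMatrix p)ᵀ * (D * (blockMatrix p * (blockMatrix q)ᵀ)) * blockMatrix q =
      (8 : ℂ) • ((blockMatrix p)ᵀ * D * blockMatrix p) := by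
    calc _ = (blockMatrix p)ᵀ * D * blockMatrix p * ((blockMatrix q)ᵀ * blockMatrix q) := by
          simp only [Matrix.mul_assoc]
      _ = _ := by rw [transpose_mul_blockMatrix, Matrix.mul_smul, Matrix.mul_one]
  have e2 : (blockMatrix p)ᵀ * (blockMatrix p * (blockMatrix q)ᵀ * E) * blockMatrix q =
      (8 : ℂ) • ((blockMatrix q)ᵀ * E * blockMatrix q) := by
    calc _ = ((blockMatrix p)ᵀ * blockMatrix p) * ((blockMatrix q)ᵀ * E * blockMatrix q) := by
          simp only [Matrix.mul_assoc]
      _ = _ := by rw [transpose_mul_blockMatrix, Matrix.smul_mul, Matrix.one_mul]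
  rw [e1, e2, smul_comm] at h
  exact smul_right_injective _ (by norm_num : (8 : ℂ) ≠ 0) h

/-- Exclusive or with a fixed number, as a permutation. -/
def xorEquiv (b : Fin 8) : Equiv.Perm (Fin 8) where
  toFun a := a ^^^ b
  invFun a := a ^^^ b
  left_inv a := by revert a b; decide
  right_inv a := by revert a b; decide

theorem sum_xor_right {M : Type*} [AddCommMonoid M] (f : Fin 8 → M) (b : Fin 8) :
    ∑ c, f (c ^^^ b) = ∑ c, f c :=
  Equiv.sum_comp (xorEquiv b) f

theorem fin_xor_comm : ∀ a b : Fin 8, a ^^^ b = b ^^^ a := by decide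

theorem fin_xor_xor_cancel : ∀ a b : Fin 8, a ^^^ b ^^^ b = a := by decide

/-- The quantum permutation matrix on pairs (block, line). -/
noncomputable def quantumPerm (x y : Fin 15 × Fin 8) : Matrix (Fin 8) (Fin 8) ℂ :=
  if x.1 = y.1 then lineProj (y.1, x.2 ^^^ y.2) else 0

theorem quantumPerm_comm (x y : Fin 15 × Fin 8) : quantumPerm x y = quantumPerm y x := by
  unfold quantumPerm
  by_cases h : x.1 = y.1
  · rw [if_pos h, if_pos h.symm, h, fin_xor_comm]
  · rw [if_neg h, if_neg (Ne.symm h)]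

theorem sum_smul_quantumPerm (f : Fin 15 × Fin 8 → ℤ) (y : Fin 15 × Fin 8) :
    ∑ z, f z • quantumPerm z y = ∑ d, f (y.1, d ^^^ y.2) • lineProj (y.1, d) := by
  rw [Fintype.sum_prod_type, Finset.sum_eq_single y.1]
  · rw [← sum_xor_right _ y.2]
    simp [quantumPerm, fin_xor_xor_cancel]
  · intro r _ hr
    simp [quantumPerm, hr]
  · simp

theorem sum_quantumPerm_left (y : Fin 15 × Fin 8) : ∑ z, quantumPerm z y = 1 := by
  have h := sum_smul_quantumPerm (fun _ => 1) y
  simpa [sum_lineProj] using h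

theorem sum_quantumPerm_right (x : Fin 15 × Fin 8) : ∑ z, quantumPerm x z = 1 := by
  simp_rw [quantumPerm_comm x]
  exact sum_quantumPerm_left x

section

variable {ε ε' : Fin 15 → Fin 15 → ℤ} {hε : ∀ p q, ε p q = ε q p}
  {hε' : ∀ p q, ε' p q = ε' q p}

/-- Multiplicativity of the characters under exclusive or moves the dependence on the line of y into
the scalar sign and leaves a symmetry depending only on the two blocks. -/
theorem sum_twiceAdj_smul_quantumPerm_of_ne (hs : ∀ p q, ε p q = 1 ∨ ε p q = -1)
    {x y : Fin 15 × Fin 8} (h : x.1 ≠ y.1) :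
    ∑ z, twiceAdj ε hε x z • quantumPerm z y =
      1 + pairSign ε x y • ∑ d, blockChar x.1 y.1 d • lineProj (y.1, d) := by
  rw [sum_smul_quantumPerm, Finset.smul_sum, ← sum_lineProj y.1, ← Finset.sum_add_distrib]
  refine Finset.sum_congr rfl fun d _ => ?_
  rw [twiceAdj_of_ne hs (by exact h), add_smul, one_smul, smul_smul]
  simp only [pairSign, blockChar_xor]
  congr 2
  ring

theorem sum_twiceAdj_smul_quantumPerm_of_eq {x y : Fin 15 × Fin 8} (h : x.1 = y.1) :
    ∑ z, twiceAdj ε hε x z • quantumPerm z y = (2 : ℤ) • (1 - quantumPerm x y) := by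
  obtain ⟨p, a⟩ := x
  obtain ⟨q, b⟩ := y
  obtain rfl : p = q := h
  have hiff : ∀ d : Fin 8, a = d ^^^ b ↔ d = a ^^^ b := by revert a b; decide
  rw [sum_smul_quantumPerm, ← sum_lineProj p]
  simp [twiceAdj_self, sub_smul, Finset.sum_sub_distrib, smul_sub, quantumPerm, hiff, ite_smul,
    Finset.mul_sum]

/-- This is twice the identity A u = u A'. The right side is transposed, which is allowed because u
and A' are symmetric in their indices. -/
theorem sum_twiceAdj_smul_quantumPerm (hs : ∀ p q, ε p q = 1 ∨ ε p q = -1)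
    (hs' : ∀ p q, ε' p q = 1 ∨ ε' p q = -1)
    (hee : ∀ p q, p ≠ q → ε p q = -repSign p q * ε' p q) (x y : Fin 15 × Fin 8) :
    ∑ z, twiceAdj ε hε x z • quantumPerm z y = ∑ z, twiceAdj ε' hε' y z • quantumPerm z x := by
  by_cases h : x.1 = y.1
  · rw [sum_twiceAdj_smul_quantumPerm_of_eq h, sum_twiceAdj_smul_quantumPerm_of_eq h.symm,
      quantumPerm_comm]
  · rw [sum_twiceAdj_smul_quantumPerm_of_ne hs h,
      sum_twiceAdj_smul_quantumPerm_of_ne hs' (Ne.symm h), sum_blockChar_smul_lineProj h, smul_smul,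
      pairSign_comm hε' y x]
    congr 2
    simp only [pairSign, hee _ _ h]
    ring

open scoped Matrix.Norms.L2Operator in
theorem quantumIsomorphic_of_signGraph {G H : SimpleGraph E8Line}
    (hG : ∀ x y, G.Adj (lineEquiv x) (lineEquiv y) ↔ (signGraph ε hε).Adj x y)
    (hH : ∀ x y, H.Adj (lineEquiv x) (lineEquiv y) ↔ (signGraph ε' hε').Adj x y)
    (hs : ∀ p q, ε p q = 1 ∨ ε p q = -1) (hs' : ∀ p q, ε' p q = 1 ∨ ε' p q = -1)
    (hee : ∀ p q, p ≠ q → ε p q = -repSign p q * ε' p q) : QuantumIsomorphic G H := by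
  classical
  refine ⟨Matrix (Fin 8) (Fin 8) ℂ, inferInstance, inferInstance,
    of fun v w => quantumPerm (lineEquiv.symm v) (lineEquiv.symm w), ⟨?_, ?_, ?_⟩, ?_⟩
  · intro v w
    rw [of_apply, quantumPerm]
    split_ifs
    · exact isStarProjection_lineProj _
    · exact IsStarProjection.zero _
  · intro v
    exact (lineEquiv.symm.sum_comp _).trans (sum_quantumPerm_right _)
  · intro w
    exact (lineEquiv.symm.sum_comp fun z => quantumPerm z (lineEquiv.symm w)).trans
      (sum_quantumPerm_left _)
  · have hadj : ∀ (b : Prop) [Decidable b] (X : Matrix (Fin 8) (Fin 8) ℂ),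
        (2 : ℤ) • ((if b then 1 else 0) * X) = ((2 : ℤ) * if b then 1 else 0) • X :=
      fun b _ X => by split_ifs <;> simp
    ext1 v w
    obtain ⟨x, rfl⟩ := lineEquiv.surjective v
    obtain ⟨y, rfl⟩ := lineEquiv.surjective w
    have hinj : ∀ X Y : Matrix (Fin 8) (Fin 8) ℂ, (2 : ℤ) • X = (2 : ℤ) • Y → X = Y := by
      intro X Y h
      ext i j
      have hij := congrFun (congrFun h i) j
      simpa [Matrix.smul_apply] using hij
    refine hinj _ _ ?_
    have key := sum_twiceAdj_smul_quantumPerm (hε := hε) (hε' := hε') hs hs' hee x y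
    simp only [twiceAdj, ← hG, ← hH] at key
    simp only [mul_apply, of_apply, SimpleGraph.adjMatrix_apply, Equiv.symm_apply_apply,
      ← lineEquiv.sum_comp, Finset.smul_sum]
    convert key using 2 with z _ z _
    · exact hadj _ _
    · rw [H.adj_comm, quantumPerm_comm]
      split_ifs <;> simp

end

/-! ### Configurations of nine lines -/

/-- Nine vectors in ℤ⁸ are dependent; dividing a relation by the gcd of its coefficients leaves an
odd one. -/
theorem exists_relation_with_odd_coeff (v : Fin 9 → Fin 8 → ℤ) :
    ∃ z : Fin 9 → ℤ, (∃ i, ¬ (2 : ℤ) ∣ z i) ∧ ∑ i, z i • v i = 0 := by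
  have hdep : ¬ LinearIndependent ℤ v := fun h => by
    have := h.fintype_card_le_finrank
    simp at this
  obtain ⟨g, hg, i, hi⟩ := Fintype.not_linearIndependent_iff.1 hdep
  obtain ⟨z, hz, hgcd⟩ := Finset.extract_gcd g (s := Finset.univ) ⟨i, Finset.mem_univ i⟩
  refine ⟨z, ?_, ?_⟩
  · by_contra! h
    have := Finset.dvd_gcd (s := Finset.univ) (f := z) (fun i _ => h i)
    rw [hgcd] at this
    norm_num at this
  · have hd : Finset.univ.gcd g ≠ 0 := fun h => hi (Finset.gcd_eq_zero_iff.1 h i (Finset.mem_univ i))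
    refine smul_right_injective _ hd ?_
    simp only [smul_zero, Finset.smul_sum, smul_smul]
    rw [← hg]
    exact Finset.sum_congr rfl fun j hj => by rw [hz j hj]

theorem sum_sum_eq_diag_add_two_mul {f : Fin 9 → Fin 9 → ℤ} (hf : ∀ i j, f i j = f j i) :
    ∑ i, ∑ j, f i j = ∑ i, f i i + 2 * ∑ i, ∑ j, if i < j then f i j else 0 := by
  have h : ∀ i j, f i j = (if i = j then f i i else 0) + (if i < j then f i j else 0) +
      if j < i then f j i else 0 := fun i j => by
    rcases lt_trichotomy i j with h | h | h
    · simp [h, h.ne, h.not_gt]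
    · simp [h]
    · simp [h, h.ne', h.not_gt, hf i j]
  rw [Finset.sum_congr rfl fun i _ => Finset.sum_congr rfl fun j _ => h i j]
  simp only [Finset.sum_add_distrib]
  rw [Finset.sum_comm (f := fun i j => if j < i then f j i else 0)]
  simp
  ring

/-- Take ζ to be a relation z with an odd coefficient, reduced mod 2. Pairing Σ z_i v_i = 0 with
each v_i and dividing by 4 gives the radical condition; its squared norm divided by 8 gives the
quadratic one. -/
theorem exists_isotropic_of_gram {v : Fin 9 → Fin 8 → ℤ} {c : Fin 9 → Fin 9 → ℤ}
    (hc : ∀ i j, i ≠ j → v i ⬝ᵥ v j = 4 * c i j) (hd : ∀ i, v i ⬝ᵥ v i = 8) :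
    ∃ ζ : Fin 9 → ZMod 2, ζ ≠ 0 ∧ (∀ i, ∑ j, (if i = j then 0 else (c i j : ZMod 2) * ζ j) = 0) ∧
      ∑ i, ζ i * ζ i + ∑ i, ∑ j, (if i < j then (c i j : ZMod 2) * (ζ i * ζ j) else 0) = 0 := by
  obtain ⟨z, ⟨k, hk⟩, hz⟩ := exists_relation_with_odd_coeff v
  have hrow : ∀ i, ∑ j, z j * (v i ⬝ᵥ v j) = 0 := fun i => by
    have := congrArg (fun w => v i ⬝ᵥ w) hz
    simpa only [dotProduct_sum, dotProduct_smul, smul_eq_mul, dotProduct_zero] using this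
  refine ⟨fun i => (z i : ZMod 2), fun h => hk ?_, fun i => ?_, ?_⟩
  · exact (ZMod.intCast_zmod_eq_zero_iff_dvd (z k) 2).1 (congrFun h k)
  · have h : 2 * z i + ∑ j, (if i = j then 0 else c i j * z j) = 0 := by
      have hterm : ∀ j, z j * (v i ⬝ᵥ v j) =
          4 * ((if i = j then 2 * z i else 0) + if i = j then 0 else c i j * z j) := fun j => by
        by_cases hij : i = j
        · subst hij
          simp [hd]
          ring
        · simp [hij, hc i j hij]
          ring
      have := hrow i
      rw [Finset.sum_congr rfl fun j _ => hterm j, ← Finset.mul_sum, Finset.sum_add_distrib] at this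
      simp at this
      exact this
    have h' := congrArg (Int.cast : ℤ → ZMod 2) h
    have h2 : (2 : ZMod 2) = 0 := rfl
    simpa [h2] using h'
  · have h : ∑ i, z i * z i + ∑ i, ∑ j, (if i < j then c i j * (z i * z j) else 0) = 0 := by
      have hsum : ∑ i, ∑ j, z i * (z j * (v i ⬝ᵥ v j)) = 0 := by
        simp [← Finset.mul_sum, hrow]
      rw [sum_sum_eq_diag_add_two_mul fun i j => by rw [dotProduct_comm]; ring] at hsum
      have h1 : ∑ i, z i * (z i * (v i ⬝ᵥ v i)) = 8 * ∑ i, z i * z i := by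
        rw [Finset.mul_sum]
        exact Finset.sum_congr rfl fun i _ => by rw [hd]; ring
      have h2 : ∑ i, ∑ j, (if i < j then z i * (z j * (v i ⬝ᵥ v j)) else 0) =
          4 * ∑ i, ∑ j, if i < j then c i j * (z i * z j) else 0 := by
        simp only [Finset.mul_sum]
        refine Finset.sum_congr rfl fun i _ => Finset.sum_congr rfl fun j _ => ?_
        split_ifs with hij
        · rw [hc i j hij.ne]
          ring
        · simp
      rw [h1, h2] at hsum
      omega
    have h' := congrArg (Int.cast : ℤ → ZMod 2) h
    push_cast at h'
    exact h'

/-- A form on `𝔽₂⁹` (with the diagonal of `B` ignored) whose radical contains no nonzero singular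
vector; it is not the form of nine lines in dimension eight. -/
def HasAnisotropicRadical (B : Fin 9 → Fin 9 → ZMod 2) : Prop :=
  ∀ ζ : Fin 9 → ZMod 2, (∀ i, ∑ j, (if i = j then 0 else B i j * ζ j) = 0) →
    ∑ i, ζ i * ζ i + ∑ i, ∑ j, (if i < j then B i j * (ζ i * ζ j) else 0) = 0 → ζ = 0

/-- Inner products of distinct scaled lines are 0 or ±4. Divided by 4 and reduced mod 2 they forget
the sign, so adjacency alone determines the form. -/
theorem not_e8Graph_configuration {B : Fin 9 → Fin 9 → ZMod 2} (hB : HasAnisotropicRadical B)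
    (v : Fin 9 → E8Line)
    (hv : ∀ i j, i ≠ j → v i ≠ v j ∧ (e8Graph.Adj (v i) (v j) ↔ B i j = 0)) : False := by
  obtain ⟨x, hx⟩ : ∃ x : Fin 9 → Fin 15 × Fin 8, ∀ i, v i = lineEquiv (x i) :=
    ⟨fun i => lineEquiv.symm (v i), fun i => by simp⟩
  have hc : ∀ i j, ∃ c : ℤ, i ≠ j →
      scaledVec (x i) ⬝ᵥ scaledVec (x j) = 4 * c ∧ (c : ZMod 2) = B i j := fun i j => by
    by_cases hij : i = j
    · exact ⟨0, fun h => absurd hij h⟩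
    obtain ⟨hne, hadj⟩ := hv i j hij
    rw [hx, hx, e8Graph_adj] at hadj
    rw [hx, hx, Ne, EmbeddingLike.apply_eq_iff_eq] at hne
    have h01 : ∀ b : ZMod 2, b ≠ 0 → b = 1 := by decide
    by_cases h0 : scaledVec (x i) ⬝ᵥ scaledVec (x j) = 0
    · exact ⟨0, fun _ => ⟨by rw [h0]; rfl,
        by rw [hadj.1 ((scaledVec_dotProduct_eq_zero_iff _ _).1 h0)]; rfl⟩⟩
    · have hB1 : B i j = 1 := h01 _ fun h =>
        h0 ((scaledVec_dotProduct_eq_zero_iff _ _).2 (hadj.2 h))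
      have hblock : (x i).1 ≠ (x j).1 := fun h =>
        h0 (by rw [scaledVec_dotProduct_of_eq h, if_neg hne])
      rcases scaledVec_dotProduct_of_ne hblock with ⟨-, h⟩ | ⟨-, h | h⟩
      · exact absurd h h0
      · exact ⟨1, fun _ => ⟨by rw [h]; rfl, by rw [hB1]; rfl⟩⟩
      · exact ⟨-1, fun _ => ⟨by rw [h]; rfl, by rw [hB1]; rfl⟩⟩
  choose c hc using hc
  obtain ⟨ζ, hζ, hrow, hq⟩ := exists_isotropic_of_gram (v := fun i => scaledVec (x i)) (c := c)
    (fun i j hij => (hc i j hij).1) fun i => by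
      rw [scaledVec_dotProduct_of_eq rfl, if_pos rfl]
  refine hζ (hB ζ (fun i => ?_) ?_)
  · refine (Finset.sum_congr rfl fun j _ => ?_).trans (hrow i)
    split_ifs with hij
    · rfl
    · rw [(hc i j hij).2]
  · refine (congrArg (fun t => ∑ i, ζ i * ζ i + t) (Finset.sum_congr rfl fun i _ =>
      Finset.sum_congr rfl fun j _ => ?_)).trans hq
    split_ifs with hij
    · rw [(hc i j hij.ne).2]
    · rfl

/-- The radical is spanned by the all-ones vector, whose quadratic value 9 + 36 is odd. -/
theorem hasAnisotropicRadical_one : HasAnisotropicRadical fun _ _ => 1 := by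
  unfold HasAnisotropicRadical
  decide +kernel

/-! ### Independence numbers -/

theorem SimpleGraph.Iso.indepNum_le {V W : Type*} [Finite V] [Finite W] {G : SimpleGraph V}
    {H : SimpleGraph W} (φ : G ≃g H) : G.indepNum ≤ H.indepNum := by
  obtain ⟨s, hs⟩ := G.exists_isNIndepSet_indepNum
  have ht : H.IsIndepSet (s.map φ.toEquiv.toEmbedding : Finset W) := by
    intro v hv w hw hne
    simp only [Finset.coe_map, Set.mem_image] at hv hw
    obtain ⟨v, hv, rfl⟩ := hv
    obtain ⟨w, hw, rfl⟩ := hw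
    have hvw := hs.isIndepSet hv hw fun h => hne (by rw [h])
    exact fun h => hvw (φ.map_adj_iff.1 h)
  simpa [hs.card_eq] using ht.card_le_indepNum

theorem isEmpty_iso_of_indepNum_lt {V W : Type*} [Finite V] [Finite W] {G : SimpleGraph V}
    {H : SimpleGraph W} (h : G.indepNum < H.indepNum) : IsEmpty (G ≃g H) :=
  ⟨fun φ => h.not_ge φ.symm.indepNum_le⟩

theorem e8Graph_indepNum_le : e8Graph.indepNum ≤ 8 := by
  by_contra! h
  obtain ⟨s, hs⟩ := e8Graph.exists_isNIndepSet_indepNum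
  obtain ⟨t, hts, ht⟩ := Finset.exists_subset_card_eq (s := s) (n := 9) (by rw [hs.card_eq]; exact h)
  let e := t.equivFinOfCardEq ht
  refine not_e8Graph_configuration hasAnisotropicRadical_one (fun i => (e.symm i : E8Line))
    fun i j hij => ?_
  have hne : (e.symm i : E8Line) ≠ e.symm j := fun h => hij (e.symm.injective (Subtype.ext h))
  refine ⟨hne, iff_of_false ?_ one_ne_zero⟩
  exact hs.isIndepSet (hts (e.symm i).2) (hts (e.symm j).2) hne

/-- A set of lines that is independent in a graph of the family meets each block at most once. -/
theorem eq_of_isIndepSet_of_block_eq {G : SimpleGraph E8Line} {ε : Fin 15 → Fin 15 → ℤ}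
    {hε : ∀ p q, ε p q = ε q p}
    (hG : ∀ x y, G.Adj (lineEquiv x) (lineEquiv y) ↔ (signGraph ε hε).Adj x y)
    {s : Set E8Line} (hs : G.IsIndepSet s) {v w : E8Line} (hv : v ∈ s) (hw : w ∈ s)
    (h : (lineEquiv.symm v).1 = (lineEquiv.symm w).1) : v = w := by
  by_contra hne
  refine hs hv hw hne ?_
  rw [← lineEquiv.apply_symm_apply v, ← lineEquiv.apply_symm_apply w, hG]
  exact .inl ⟨h, fun h' => hne (lineEquiv.symm.injective h')⟩

/-- Outside V_15 switching changes nothing, so that part of an independent set has at most 8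
elements; the clique V_15 adds at most one. -/
theorem switchedE8Graph_indepNum_le : switchedE8Graph.indepNum ≤ 9 := by
  classical
  obtain ⟨s, hs⟩ := switchedE8Graph.exists_isNIndepSet_indepNum
  rw [← hs.card_eq, ← Finset.card_filter_add_card_filter_not
    (fun v => (lineEquiv.symm v).1 = Fin.last 14)]
  have h1 : (s.filter fun v => (lineEquiv.symm v).1 = Fin.last 14).card ≤ 1 := by
    refine Finset.card_le_one.2 fun v hv w hw => ?_
    rw [Finset.mem_filter] at hv hw
    exact eq_of_isIndepSet_of_block_eq switchedE8Graph_adj hs.isIndepSet hv.1 hw.1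
      (hv.2.trans hw.2.symm)
  have h2 : (s.filter fun v => ¬ (lineEquiv.symm v).1 = Fin.last 14).card ≤ 8 := by
    refine le_trans (SimpleGraph.IsIndepSet.card_le_indepNum (G := e8Graph) ?_) e8Graph_indepNum_le
    intro v hv w hw hne hadj
    rw [Finset.mem_coe, Finset.mem_filter] at hv hw
    refine hs.isIndepSet hv.1 hw.1 hne ?_
    obtain ⟨x, rfl⟩ := lineEquiv.surjective v
    obtain ⟨y, rfl⟩ := lineEquiv.surjective w
    rw [Equiv.symm_apply_apply] at hv hw
    rw [e8Graph_adj] at hadj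
    rw [switchedE8Graph_adj]
    simpa only [signGraph, pairSign, switchSign, if_pos (iff_of_false hv.2 hw.2)] using hadj
  omega

/-- At the lines numbered 0 all characters are 1, so the sign of a pair is ε itself. -/
theorem le_indepNum_of_representatives {G : SimpleGraph E8Line} {ε : Fin 15 → Fin 15 → ℤ}
    {hε : ∀ p q, ε p q = ε q p}
    (hG : ∀ x y, G.Adj (lineEquiv x) (lineEquiv y) ↔ (signGraph ε hε).Adj x y)
    {n : ℕ} {f : Fin n → Fin 15} (hf : Function.Injective f)
    (hneg : ∀ i j, i ≠ j → ε (f i) (f j) = -1) : n ≤ G.indepNum := by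
  classical
  have hinj : Function.Injective fun i => lineEquiv (f i, 0) := fun i j h => hf (by simpa using h)
  have hs : G.IsIndepSet (Finset.univ.image fun i => lineEquiv (f i, 0) : Finset E8Line) := by
    intro v hv w hw hne
    simp only [Finset.coe_image, Finset.coe_univ, Set.image_univ, Set.mem_range] at hv hw
    obtain ⟨i, rfl⟩ := hv
    obtain ⟨j, rfl⟩ := hw
    have hij : i ≠ j := fun h => hne (by rw [h])
    rw [hG]
    simp [signGraph, pairSign, blockChar_zero, hf.ne hij, hneg i j hij]
  simpa [Finset.card_image_of_injective _ hinj] using hs.card_le_indepNum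

theorem le_e8TwistedGraph_indepNum : 15 ≤ e8TwistedGraph.indepNum :=
  le_indepNum_of_representatives (fun _ _ => e8TwistedGraph_adj) (f := id) Function.injective_id
    fun _ _ _ => rfl

theorem le_switchedTwistedGraph_indepNum : 14 ≤ switchedTwistedGraph.indepNum :=
  le_indepNum_of_representatives switchedTwistedGraph_adj (f := Fin.castSucc)
    (Fin.castSucc_injective _) fun i j _ =>
      if_pos (iff_of_false (Fin.castSucc_ne_last i) (Fin.castSucc_ne_last j))

/-- A `3 × 3` grid of blocks: on each block of a row, the three characters belonging to the
blocks of the crossing line multiply to `1`. -/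
theorem blockChar_grid : ∀ a : Fin 8,
    (blockChar 3 0 a * blockChar 10 0 a * blockChar 14 0 a = 1 ∧
    blockChar 3 1 a * blockChar 10 1 a * blockChar 14 1 a = 1 ∧
    blockChar 3 2 a * blockChar 10 2 a * blockChar 14 2 a = 1) ∧
    blockChar 0 3 a * blockChar 1 3 a * blockChar 2 3 a = 1 ∧
    blockChar 0 10 a * blockChar 1 10 a * blockChar 2 10 a = 1 ∧
    blockChar 0 14 a * blockChar 1 14 a * blockChar 2 14 a = 1 := by
  decide +kernel

/-- An independent set of 15 lines would pick one line in every block. Consider the nine pairs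
between the blocks 0, 1, 2 and the blocks 3, 10, 14, which lie on two skew projective lines.
Non-adjacency forces the character product of a pair to be 1, or -1 if block 14 is involved, so the
total is (-1)³. Regrouped by blocks, `blockChar_grid` makes the total 1. -/
theorem switchedTwistedGraph_indepNum_le : switchedTwistedGraph.indepNum ≤ 14 := by
  classical
  by_contra! h
  obtain ⟨s, hs⟩ := switchedTwistedGraph.exists_isNIndepSet_indepNum
  have himage : s.image (fun v => (lineEquiv.symm v).1) = Finset.univ := by
    refine Finset.eq_univ_of_card _ (le_antisymm (Finset.card_le_univ _) ?_)
    rw [Finset.card_image_of_injOn, hs.card_eq, Fintype.card_fin]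
    · exact h
    · exact fun v hv w hw hvw =>
        eq_of_isIndepSet_of_block_eq switchedTwistedGraph_adj hs.isIndepSet hv hw hvw
  have hex : ∀ p, ∃ a, lineEquiv (p, a) ∈ s := fun p => by
    obtain ⟨v, hv, rfl⟩ := Finset.mem_image.1 (himage ▸ Finset.mem_univ p)
    exact ⟨(lineEquiv.symm v).2, by simpa using hv⟩
  choose a ha using hex
  have hsign : ∀ p q, p ≠ q →
      switchSign (fun _ _ => -1) p q * (blockChar q p (a p) * blockChar p q (a q)) = -1 :=
    fun p q hpq => by
      have hnot : ¬ switchedTwistedGraph.Adj (lineEquiv (p, a p)) (lineEquiv (q, a q)) :=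
        hs.isIndepSet (ha p) (ha q) fun h =>
          hpq (congrArg Prod.fst (lineEquiv.injective h))
      rw [switchedTwistedGraph_adj] at hnot
      rw [← mul_assoc]
      exact (pairSign_eq_one_or (switchSign_eq_one_or fun _ _ => .inr rfl) (p, a p)
        (q, a q)).resolve_left fun h => hnot (.inr ⟨hpq, h⟩)
  have hoff : ∀ p q : Fin 15, p ≠ q → p ≠ 14 → q ≠ 14 →
      blockChar q p (a p) * blockChar p q (a q) = 1 := fun p q hpq hp hq => by
    have := hsign p q hpq
    rw [switchSign, if_pos (show p = Fin.last 14 ↔ q = Fin.last 14 from iff_of_false hp hq)] at this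
    linarith
  have hon : ∀ p : Fin 15, p ≠ 14 → blockChar 14 p (a p) * blockChar p 14 (a 14) = -1 :=
    fun p hp => by
      have := hsign p 14 hp
      rw [switchSign, if_neg (show ¬ (p = Fin.last 14 ↔ (14 : Fin 15) = Fin.last 14) from
        fun h => hp (h.2 rfl))] at this
      linarith
  obtain ⟨⟨c0, -⟩, -⟩ := blockChar_grid (a 0)
  obtain ⟨⟨-, c1, -⟩, -⟩ := blockChar_grid (a 1)
  obtain ⟨⟨-, -, c2⟩, -⟩ := blockChar_grid (a 2)
  obtain ⟨-, r3, -⟩ := blockChar_grid (a 3)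
  obtain ⟨-, -, r10, -⟩ := blockChar_grid (a 10)
  obtain ⟨-, -, -, r14⟩ := blockChar_grid (a 14)
  -- The product of the three pair conditions at p, regrouped; the only minus sign comes from the
  -- switched block 14.
  have hprod : ∀ p : Fin 15, p ≠ 3 → p ≠ 10 → p ≠ 14 →
      (blockChar 3 p (a p) * blockChar 10 p (a p) * blockChar 14 p (a p)) *
      (blockChar p 3 (a 3) * blockChar p 10 (a 10) * blockChar p 14 (a 14)) = -1 :=
    fun p h3 h10 h14 => by
      have e3 := hoff p 3 h3 h14 (by decide)
      have e10 := hoff p 10 h10 h14 (by decide)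
      have e14 := hon p h14
      calc _ = (blockChar 3 p (a p) * blockChar p 3 (a 3)) *
            (blockChar 10 p (a p) * blockChar p 10 (a 10)) *
            (blockChar 14 p (a p) * blockChar p 14 (a 14)) := by ring
        _ = -1 := by rw [e3, e10, e14]; rfl
  have p0 := hprod 0 (by decide) (by decide) (by decide)
  have p1 := hprod 1 (by decide) (by decide) (by decide)
  have p2 := hprod 2 (by decide) (by decide) (by decide)
  rw [c0, one_mul] at p0
  rw [c1, one_mul] at p1
  rw [c2, one_mul] at p2
  have hcontra : (1 : ℤ) = -1 := by
    calc (1 : ℤ) = (blockChar 0 3 (a 3) * blockChar 1 3 (a 3) * blockChar 2 3 (a 3)) *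
          (blockChar 0 10 (a 10) * blockChar 1 10 (a 10) * blockChar 2 10 (a 10)) *
          (blockChar 0 14 (a 14) * blockChar 1 14 (a 14) * blockChar 2 14 (a 14)) := by
          rw [r3, r10, r14]; rfl
      _ = (blockChar 0 3 (a 3) * blockChar 0 10 (a 10) * blockChar 0 14 (a 14)) *
          (blockChar 1 3 (a 3) * blockChar 1 10 (a 10) * blockChar 1 14 (a 14)) *
          (blockChar 2 3 (a 3) * blockChar 2 10 (a 10) * blockChar 2 14 (a 14)) := by ring
      _ = -1 := by rw [p0, p1, p2]; rfl
  exact absurd hcontra (by decide)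

/-! ### A configuration of nine lines in the switched graph -/

/-- Nine lines whose relations in the switched graph do not occur in `e8Graph`. -/
def nineLines : Fin 9 → Fin 15 × Fin 8 :=
  ![(1, 6), (14, 3), (12, 2), (7, 5), (8, 3), (11, 6), (0, 4), (12, 5), (6, 4)]

/-- Non-adjacency of the nine lines in the switched graph. -/
def nineForm : Fin 9 → Fin 9 → ZMod 2 := ![
  ![0, 1, 0, 0, 0, 0, 1, 1, 0], ![1, 0, 0, 0, 0, 0, 1, 0, 0], ![0, 0, 0, 0, 1, 1, 0, 0, 1],
  ![0, 0, 0, 0, 0, 1, 0, 1, 0], ![0, 0, 1, 0, 0, 1, 1, 0, 0], ![0, 0, 1, 1, 1, 0, 0, 1, 0],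
  ![1, 1, 0, 0, 1, 0, 0, 1, 1], ![1, 0, 0, 1, 0, 1, 1, 0, 0], ![0, 0, 1, 0, 0, 0, 1, 0, 0]]

theorem hasAnisotropicRadical_nineForm : HasAnisotropicRadical nineForm := by
  unfold HasAnisotropicRadical
  decide +kernel

theorem nineLines_spec : ∀ i j, i ≠ j → nineLines i ≠ nineLines j ∧
    ((((nineLines i).1 = (nineLines j).1 ∧ nineLines i ≠ nineLines j) ∨
      ((nineLines i).1 ≠ (nineLines j).1 ∧
        pairSign (switchSign repSign) (nineLines i) (nineLines j) = 1)) ↔ nineForm i j = 0) := by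
  decide +kernel

/-- The independence bounds leave this pair open. An isomorphism would carry the nine lines to nine
lines of `e8Graph` whose Gram form mod 2 is `nineForm`, which dimension eight forbids. -/
theorem isEmpty_switchedE8Graph_iso_e8Graph : IsEmpty (switchedE8Graph ≃g e8Graph) := by
  refine ⟨fun φ => not_e8Graph_configuration hasAnisotropicRadical_nineForm
    (fun i => φ (lineEquiv (nineLines i))) fun i j hij => ?_⟩
  obtain ⟨hne, hadj⟩ := nineLines_spec i j hij
  refine ⟨fun h => hne (lineEquiv.injective (φ.injective h)), ?_⟩
  rw [φ.map_adj_iff, switchedE8Graph_adj, ← hadj]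
  rfl

/-! ### Comparison of the four graphs -/

open Classical in
theorem mainTheorem4 :
    -- Godsil-McKay switching applies to both graphs, with the neighbour counts 4 = |V_i| / 2
    GMPartition e8Graph e8Cells e8Special ∧
    GMPartition e8TwistedGraph e8Cells e8Special ∧
    (∀ i, (e8Block i).ncard = 8) ∧
    (∀ i j, i ≠ j → ∀ v ∈ e8Block i,
      (e8Graph.neighborSet v ∩ e8Block j).ncard = 4 ∧
      (e8TwistedGraph.neighborSet v ∩ e8Block j).ncard = 4) ∧
    -- the switched graphs are quantum isomorphic, non-isomorphic and strongly regular
    QuantumIsomorphic switchedE8Graph switchedTwistedGraph ∧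
    IsEmpty (switchedE8Graph ≃g switchedTwistedGraph) ∧
    switchedE8Graph.IsSRGWith 120 63 30 36 ∧
    switchedTwistedGraph.IsSRGWith 120 63 30 36 ∧
    -- independence numbers
    switchedE8Graph.indepNum ≤ 9 ∧
    14 ≤ switchedTwistedGraph.indepNum ∧
    -- the switched graphs are new
    IsEmpty (switchedE8Graph ≃g e8Graph) ∧
    IsEmpty (switchedE8Graph ≃g e8TwistedGraph) ∧
    IsEmpty (switchedTwistedGraph ≃g e8Graph) ∧
    IsEmpty (switchedTwistedGraph ≃g e8TwistedGraph) := by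
  have hE8 : ∀ x y, e8Graph.Adj (lineEquiv x) (lineEquiv y) ↔
      (signGraph repSign repSign_comm).Adj x y := fun _ _ => e8Graph_adj
  have hTw : ∀ x y, e8TwistedGraph.Adj (lineEquiv x) (lineEquiv y) ↔
      (signGraph (fun _ _ => -1) fun _ _ => rfl).Adj x y := fun _ _ => e8TwistedGraph_adj
  have hneg : ∀ _ _ : Fin 15, (-1 : ℤ) = 1 ∨ (-1 : ℤ) = -1 := fun _ _ => .inr rfl
  have hα := e8Graph_indepNum_le
  have hα₁ := switchedE8Graph_indepNum_le
  have hα₂ := switchedTwistedGraph_indepNum_le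
  have hβ := le_e8TwistedGraph_indepNum
  have hβ₂ := le_switchedTwistedGraph_indepNum
  refine ⟨gmPartition_of_signGraph hE8 repSign_eq_one_or, gmPartition_of_signGraph hTw hneg,
    ncard_e8Block, fun i j hij v hv => ⟨ncard_neighborSet_inter_of_ne hE8 repSign_eq_one_or hij hv,
      ncard_neighborSet_inter_of_ne hTw hneg hij hv⟩, ?_, ?_, ?_, ?_, hα₁, hβ₂,
    isEmpty_switchedE8Graph_iso_e8Graph, ?_, ?_, ?_⟩
  · refine quantumIsomorphic_of_signGraph switchedE8Graph_adj switchedTwistedGraph_adj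
      (switchSign_eq_one_or repSign_eq_one_or) (switchSign_eq_one_or hneg) fun p q _ => ?_
    unfold switchSign
    split_ifs <;> ring
  -- Independence numbers: at most 9 against at least 14.
  · exact isEmpty_iso_of_indepNum_lt (by omega)
  · exact isSRGWith_of_signGraph switchedE8Graph_adj (switchSign_eq_one_or repSign_eq_one_or)
      (switchSign_mul_thirdBlock repSign_mul_thirdBlock)
  · exact isSRGWith_of_signGraph switchedTwistedGraph_adj (switchSign_eq_one_or hneg)
      (switchSign_mul_thirdBlock fun _ _ _ => rfl)
  · exact isEmpty_iso_of_indepNum_lt (by omega)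
  · exact ⟨fun φ => absurd φ.indepNum_le (by omega)⟩
  · exact isEmpty_iso_of_indepNum_lt (by omega)
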